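/- Let $d,k\in\mathbb N$ with $1<k<d$, let $s\in(0,1)$ and $p>1$ with $sp=k$, let $\Omega\subset\mathbb R^d$ be a bounded domain (non-empty, open, connected), and let $K\subset\Omega$ be a compact set of codimension $k$ of class $C^{0,1}$. Then $$W^{s,p}_0(\Omega\setminus K)=W^{s,p}(\Omega).$$ Here $W^{s,p}(\Omega)$ is the space of all real $u\in L^p(\Omega)$ with $[u]^p_{W^{s,p}(\Omega)}:=\int_\Omega\int_\Omega\frac{|u(x)-u(y)|^p}{|x-y|^{d+sp}}\,dx\,dy<\infty$, normed by $\|u\|_{W^{s,p}(\Omega)}=\big(\|u\|_{L^p(\Omega)}^p+[u]_{W^{s,p}(\Omega)}^p\big)^{1/p}$, and $W^{s,p}_0(\Omega\setminus K)$ is the closure in $W^{s,p}(\Omega)$, with respect to this norm, of the set of all $u\in W^{s,p}(\Omega)\cap C(\Omega)$ that vanish in a neighbourhood of $K$. Write $\xi=(\xi_k,\xi_{d-k})\in\mathbb R^k\times\mathbb R^{d-k}$, $Q=\{\xi:\ |\xi_k|<1,\ \xi_{d-k}\in(0,1)^{d-k}\}$, $\delta_K(y)=\inf_{z\in K}|y-z|$,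 and let $\|f\|_{C^{0,1}(A)}$ be the sum of $\sup_A|f|$ and the best Lipschitz constant of $f$ on $A$. The compact set $K\subset\Omega$ is of codimension $k$ of class $C^{0,1}$ if there is $C>0$ such that for every $x\in K$ there are a ball $B=B_r(x)\subset\mathbb R^d$, $r>0$, and a bijection $T:Q\to B$ such that $T$ and $T^{-1}$ extend to Lipschitz maps on $\overline Q$ and $\overline B$ with $\|T\|_{C^{0,1}(\overline Q)}+\|T^{-1}\|_{C^{0,1}(\overline B)}\le C$, and there are constants $C_1,C_2>0$ with $C_1|\xi_k|\le\delta_K(T(\xi))\le C_2|\xi_k|$ for all $\xi\in Q$ with $T(\xi)\in\Omega\setminus K$. -/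

import Mathlib

open MeasureTheory Filter Topology
open scoped ENNReal NNReal

noncomputable section

/-- The `p`-th power `[u]^p` of the Gagliardo seminorm of `u` over `Ω ⊆ ℝ^d`, with values in
`[0, ∞]`. -/
def gagliardo {d : ℕ} (Ω : Set (EuclideanSpace ℝ (Fin d))) (s p : ℝ)
    (u : EuclideanSpace ℝ (Fin d) → ℝ) : ℝ≥0∞ :=
  ∫⁻ x in Ω, ∫⁻ y in Ω, ENNReal.ofReal (|u x - u y| ^ p / ‖x - y‖ ^ ((d : ℝ) + s * p))

/-- The norm `(‖u‖_{L^p(Ω)}^p + [u]^p)^{1/p}`, with values in `[0, ∞]`. -/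
def fracSobolevNorm {d : ℕ} (Ω : Set (EuclideanSpace ℝ (Fin d))) (s p : ℝ)
    (u : EuclideanSpace ℝ (Fin d) → ℝ) : ℝ≥0∞ :=
  (eLpNorm u (ENNReal.ofReal p) (volume.restrict Ω) ^ p + gagliardo Ω s p u) ^ (1 / p)

/-- The fractional Sobolev space `W^{s,p}(Ω)`, as a set of classes in `L^p(Ω)`. -/
def fracSobolev {d : ℕ} (Ω : Set (EuclideanSpace ℝ (Fin d))) (s p : ℝ) :
    Set (Lp ℝ (ENNReal.ofReal p) (volume.restrict Ω)) :=
  {u | gagliardo Ω s p u < ∞}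

/-- The classes in `W^{s,p}(Ω)` that have a representative which is continuous on `Ω` and vanishes
in a neighbourhood of `K`. -/
def fracSobolevVanishing {d : ℕ} (Ω K : Set (EuclideanSpace ℝ (Fin d))) (s p : ℝ) :
    Set (Lp ℝ (ENNReal.ofReal p) (volume.restrict Ω)) :=
  {u | u ∈ fracSobolev Ω s p ∧ ∃ v : EuclideanSpace ℝ (Fin d) → ℝ,
    u =ᵐ[volume.restrict Ω] v ∧ ContinuousOn v Ω ∧ ∀ᶠ x in 𝓝ˢ K, v x = 0}

/-- The space `W^{s,p}_0(Ω \ K)`: the closure of `fracSobolevVanishing Ω K s p` in `W^{s,p}(Ω)`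
with respect to the norm of `W^{s,p}(Ω)`. -/
def fracSobolevZero {d : ℕ} (Ω K : Set (EuclideanSpace ℝ (Fin d))) (s p : ℝ) :
    Set (Lp ℝ (ENNReal.ofReal p) (volume.restrict Ω)) :=
  {u | u ∈ fracSobolev Ω s p ∧ ∀ ε : ℝ≥0∞, 0 < ε → ∃ v ∈ fracSobolevVanishing Ω K s p,
    fracSobolevNorm Ω s p (u - v : Lp ℝ (ENNReal.ofReal p) (volume.restrict Ω)) < ε}

/-- `|ξ_k|`: the Euclidean norm of the vector of the first `k` coordinates of `ξ`. -/
def headNorm {d : ℕ} (k : ℕ) (ξ : EuclideanSpace ℝ (Fin d)) : ℝ :=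
  Real.sqrt (∑ i : Fin d, if (i : ℕ) < k then ξ i ^ 2 else 0)

/-- The open cylinder `Q = B^k_1(0) × (0,1)^{d-k}` in `ℝ^d = ℝ^k × ℝ^{d-k}`. -/
def modelCylinder (d k : ℕ) : Set (EuclideanSpace ℝ (Fin d)) :=
  {ξ | headNorm k ξ < 1 ∧ ∀ i : Fin d, k ≤ (i : ℕ) → 0 < ξ i ∧ ξ i < 1}

/-- The `C^{0,1}` norm of `f` on `A`: the supremum norm plus the best Lipschitz constant
(the pairs `x = y` contribute `0 / 0 = 0`). -/
def lipNorm {d : ℕ} (f : EuclideanSpace ℝ (Fin d) → EuclideanSpace ℝ (Fin d))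
    (A : Set (EuclideanSpace ℝ (Fin d))) : ℝ≥0∞ :=
  (⨆ x ∈ A, ‖f x‖ₑ) + ⨆ x ∈ A, ⨆ y ∈ A, edist (f x) (f y) / edist x y

/-- `K ⊆ Ω` has codimension `k` and class `C^{0,1}`: every point `x` of `K` has a ball `B_r(x)`
with a bi-Lipschitz bijection `T : Q → B_r(x)` (with inverse `S`), with `C^{0,1}` norms bounded
uniformly in `x`, such that the distance of `y = T ξ ∈ Ω \ K` to `K` is comparable to `|ξ_k|`. -/
def IsLipschitzOfCodim {d : ℕ} (Ω K : Set (EuclideanSpace ℝ (Fin d))) (k : ℕ) : Prop :=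
  ∃ C : ℝ≥0, 0 < C ∧ ∀ x ∈ K, ∃ r : ℝ, 0 < r ∧
    ∃ T S : EuclideanSpace ℝ (Fin d) → EuclideanSpace ℝ (Fin d),
      Set.BijOn T (modelCylinder d k) (Metric.ball x r) ∧
      Set.InvOn S T (modelCylinder d k) (Metric.ball x r) ∧
      lipNorm T (closure (modelCylinder d k)) + lipNorm S (closure (Metric.ball x r)) ≤ C ∧
      ∃ C₁ C₂ : ℝ, 0 < C₁ ∧ 0 < C₂ ∧ ∀ ξ ∈ modelCylinder d k, T ξ ∈ Ω \ K →
        C₁ * headNorm k ξ ≤ Metric.infDist (T ξ) K ∧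
        Metric.infDist (T ξ) K ≤ C₂ * headNorm k ξ

end

/-! In the critical case `sp = k`, a cutoff equal to `1` near `K` and supported in the
`ρ`-neighbourhood of `K` has `[ψ]^p` of order at most `ρ^(-sp)` times the volume `O(ρ^k)` of that
neighbourhood. This bound stays bounded but does not tend to zero as `ρ → 0`
(`IsLipschitzOfCodim.exists_cutoff`).

Boundedness is enough because `p > 1`: if a sequence in a linear subspace is bounded in energy and
converges almost everywhere to `u`, then `u` lies in the norm closure of the subspace. This is
`exists_mem_energy_sub_lt`, a Banach–Saks argument in which averages of well chosen members converge
in norm.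

It remains to find bounded approximants that are continuous and vanish near `K`. Averages of `u`
over balls of radius `ε dist(x, Ωᶜ)` are continuous on `Ω`, have energy controlled by that of `u`,
and converge almost everywhere. Clipping them at the variable height `N (1 - ψ)` makes them vanish
near `K`. Since clipping is Lipschitz in value and height jointly, the energies merely add up, with
no product rule. The limit is `u` truncated at `N`, and `N → ∞` recovers `u`.

The volume bound comes from the charts, once `K` is known to lie on the axis `ξ_k = 0` of each
chart. The definition controls distances only off `K`, so this needs a connectedness argument, which
uses `k ≥ 2`. -/

noncomputable section

/-! ### Sequences bounded in `L^p` that converge almost everywhere -/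

/-- Compare `a` with `t b`, where `(1 + t)^p = 2`. The size of `C` is immaterial: it only provides
an integrable majorant. -/
lemma exists_add_rpow_le {p : ℝ} (hp : 1 < p) :
    ∃ C : ℝ≥0∞, C ≠ ∞ ∧ ∀ a b : ℝ≥0∞, (a + b) ^ p ≤ C * a ^ p + 2 * b ^ p := by
  have hp0 : 0 < p := by linarith
  have h1 : (1 : ℝ≥0∞) < 2 ^ (1 / p) := ENNReal.one_lt_rpow (by norm_num) (by positivity)
  set t : ℝ≥0∞ := 2 ^ (1 / p) - 1 with ht
  have ht0 : t ≠ 0 := (tsub_pos_of_lt h1).ne'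
  have htop : t ≠ ∞ :=
    ne_top_of_le_ne_top (ENNReal.rpow_ne_top_of_nonneg (by positivity) (by norm_num)) tsub_le_self
  have h1t : 1 + t = 2 ^ (1 / p) := by rw [ht]; exact add_tsub_cancel_of_le h1.le
  refine ⟨(1 + t⁻¹) ^ p, ?_, fun a b => ?_⟩
  · exact ENNReal.rpow_ne_top_of_nonneg hp0.le (by simp [ht0])
  rcases le_total a (t * b) with h | h
  · refine le_add_left ?_
    calc (a + b) ^ p ≤ ((1 + t) * b) ^ p := by
          gcongr
          rw [add_mul, one_mul, add_comm]
          gcongr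
      _ = 2 * b ^ p := by
          rw [ENNReal.mul_rpow_of_nonneg _ _ hp0.le, h1t, ← ENNReal.rpow_mul,
            one_div_mul_cancel hp0.ne', ENNReal.rpow_one]
  · refine le_add_right ?_
    calc (a + b) ^ p ≤ ((1 + t⁻¹) * a) ^ p := by
          gcongr
          rw [add_mul, one_mul]
          gcongr
          calc b = t⁻¹ * (t * b) := by
                rw [← mul_assoc, ENNReal.inv_mul_cancel ht0 htop, one_mul]
            _ ≤ t⁻¹ * a := by gcongr
      _ = _ := ENNReal.mul_rpow_of_nonneg _ _ hp0.le

/-- A one-sided Brezis–Lieb estimate: the truncated difference `|g + f_j|^p - 2 |f_j|^p` is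
dominated by `C |g|^p` and tends to `|g|^p`. That `∫ |g|^p` appears with coefficient exactly `1` is
what permits iteration with linear growth. -/
lemma eventually_lintegral_add_rpow_le {X : Type*} [MeasurableSpace X] {ν : Measure X} {p : ℝ}
    (hp : 1 < p) {g : X → ℝ} {f : ℕ → X → ℝ} (hg : Measurable g) (hf : ∀ j, Measurable (f j))
    {M : ℝ≥0∞} (hgp : ∫⁻ x, ‖g x‖ₑ ^ p ∂ν ≠ ∞) (hfM : ∀ j, ∫⁻ x, ‖f j x‖ₑ ^ p ∂ν ≤ M)
    (hlim : ∀ᵐ x ∂ν, Tendsto (fun j => f j x) atTop (𝓝 0)) :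
    ∀ᶠ j in atTop, ∫⁻ x, ‖g x + f j x‖ₑ ^ p ∂ν ≤ (∫⁻ x, ‖g x‖ₑ ^ p ∂ν) + (2 * M + 1) := by
  have hp0 : 0 < p := by linarith
  obtain ⟨C, hC, hCab⟩ := exists_add_rpow_le hp
  have key : Tendsto (fun j => ∫⁻ x, (‖g x + f j x‖ₑ ^ p - 2 * ‖f j x‖ₑ ^ p) ∂ν) atTop
      (𝓝 (∫⁻ x, ‖g x‖ₑ ^ p ∂ν)) := by
    refine tendsto_lintegral_of_dominated_convergence (fun x => C * ‖g x‖ₑ ^ p) (fun j => ?_)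
      (fun j => ?_) ?_ ?_
    · have := hf j
      fun_prop
    · refine Eventually.of_forall fun x => ?_
      refine tsub_le_iff_right.2 (le_trans ?_ (hCab _ _))
      gcongr
      exact enorm_add_le _ _
    · rw [lintegral_const_mul' _ _ hC]
      exact ENNReal.mul_ne_top hC hgp
    · filter_upwards [hlim] with x hx
      have h1 : Tendsto (fun j => ‖g x + f j x‖ₑ ^ p) atTop (𝓝 (‖g x‖ₑ ^ p)) := by
        refine (ENNReal.continuous_rpow_const.tendsto _).comp ((continuous_enorm.tendsto _).comp ?_)
        simpa using hx.const_add (g x)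
      have h2 : Tendsto (fun j => 2 * ‖f j x‖ₑ ^ p) atTop (𝓝 0) := by
        have h3 : Tendsto (fun j => ‖f j x‖ₑ ^ p) atTop (𝓝 0) := by
          have := (ENNReal.continuous_rpow_const (y := p)).tendsto _ |>.comp
            ((continuous_enorm.tendsto _).comp hx)
          simpa [ENNReal.zero_rpow_of_pos hp0, Function.comp_def] using this
        simpa using ENNReal.Tendsto.const_mul h3 (Or.inr (by norm_num : (2 : ℝ≥0∞) ≠ ∞))
      have := ENNReal.Tendsto.sub h1 h2 (Or.inr ENNReal.zero_ne_top)
      simpa using this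
  have hlt : ∫⁻ x, ‖g x‖ₑ ^ p ∂ν < (∫⁻ x, ‖g x‖ₑ ^ p ∂ν) + 1 :=
    ENNReal.lt_add_right hgp one_ne_zero
  filter_upwards [key.eventually_lt_const hlt] with j hj
  calc ∫⁻ x, ‖g x + f j x‖ₑ ^ p ∂ν
      ≤ ∫⁻ x, ((‖g x + f j x‖ₑ ^ p - 2 * ‖f j x‖ₑ ^ p) + 2 * ‖f j x‖ₑ ^ p) ∂ν :=
        lintegral_mono fun x => le_tsub_add
    _ = (∫⁻ x, (‖g x + f j x‖ₑ ^ p - 2 * ‖f j x‖ₑ ^ p) ∂ν) + 2 * ∫⁻ x, ‖f j x‖ₑ ^ p ∂ν := by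
        have := hf j
        rw [lintegral_add_right _ (by fun_prop), lintegral_const_mul _ (by fun_prop)]
    _ ≤ ((∫⁻ x, ‖g x‖ₑ ^ p ∂ν) + 1) + 2 * M := by
        gcongr
        exact hfM j
    _ = _ := by ring

/-! ### The energy of a function -/

section Energy

variable {d : ℕ} {Ω : Set (EuclideanSpace ℝ (Fin d))} {s p : ℝ}
  {u v : EuclideanSpace ℝ (Fin d) → ℝ}

/-- The measure `|x - y|^{-d-sp} dx dy` on `Ω × Ω`. -/
def gagliardoMeasure (Ω : Set (EuclideanSpace ℝ (Fin d))) (s p : ℝ) :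
    Measure (EuclideanSpace ℝ (Fin d) × EuclideanSpace ℝ (Fin d)) :=
  ((volume.restrict Ω).prod (volume.restrict Ω)).withDensity
    fun z => ENNReal.ofReal (‖z.1 - z.2‖ ^ ((d : ℝ) + s * p))⁻¹

lemma enorm_rpow_eq_ofReal (hp : 0 ≤ p) (a : ℝ) : ‖a‖ₑ ^ p = ENNReal.ofReal (|a| ^ p) := by
  rw [Real.enorm_eq_ofReal_abs, ENNReal.ofReal_rpow_of_nonneg (abs_nonneg a) hp]

lemma gagliardo_eq_lintegral_kernel (hp : 0 ≤ p) :
    gagliardo Ω s p u = ∫⁻ x in Ω, ∫⁻ y in Ω,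
      ENNReal.ofReal (‖x - y‖ ^ ((d : ℝ) + s * p))⁻¹ * ‖u x - u y‖ₑ ^ p := by
  unfold gagliardo
  congr! 4 with x y
  rw [enorm_rpow_eq_ofReal hp, ← ENNReal.ofReal_mul (by positivity), div_eq_inv_mul]

/-- With a single measure on pairs, `L^p` estimates apply to both terms of the energy alike. -/
lemma gagliardo_eq_lintegral (hp : 0 ≤ p) (hu : Measurable u) :
    gagliardo Ω s p u = ∫⁻ z, ‖u z.1 - u z.2‖ₑ ^ p ∂(gagliardoMeasure Ω s p) := by
  rw [gagliardoMeasure, lintegral_withDensity_eq_lintegral_mul _ (by fun_prop) (by fun_prop),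
    lintegral_prod _ (by fun_prop), gagliardo_eq_lintegral_kernel hp]
  simp only [Pi.mul_apply]

/-- The `p`-th power of the norm of `W^{s,p}(Ω)`. -/
def energy (Ω : Set (EuclideanSpace ℝ (Fin d))) (s p : ℝ)
    (u : EuclideanSpace ℝ (Fin d) → ℝ) : ℝ≥0∞ :=
  (∫⁻ x in Ω, ‖u x‖ₑ ^ p) + gagliardo Ω s p u

lemma gagliardo_congr_ae (h : u =ᵐ[volume.restrict Ω] v) :
    gagliardo Ω s p u = gagliardo Ω s p v := by
  unfold gagliardo
  refine lintegral_congr_ae ?_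
  filter_upwards [h] with x hx
  refine lintegral_congr_ae ?_
  filter_upwards [h] with y hy
  rw [hx, hy]

lemma energy_congr_ae (h : u =ᵐ[volume.restrict Ω] v) : energy Ω s p u = energy Ω s p v := by
  unfold energy
  rw [gagliardo_congr_ae h]
  congr 1
  refine lintegral_congr_ae ?_
  filter_upwards [h] with x hx
  rw [hx]

lemma energy_const_mul (hp : 0 ≤ p) (c : ℝ) (hu : Measurable u) :
    energy Ω s p (fun x => c * u x) = ‖c‖ₑ ^ p * energy Ω s p u := by
  unfold energy
  rw [gagliardo_eq_lintegral hp hu, gagliardo_eq_lintegral hp (by fun_prop), mul_add,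
    ← lintegral_const_mul _ (by fun_prop), ← lintegral_const_mul _ (by fun_prop)]
  simp only [← mul_sub, enorm_mul, ENNReal.mul_rpow_of_nonneg _ _ hp]

lemma lintegral_add_rpow_le {X : Type*} [MeasurableSpace X] {ν : Measure X}
    (hp : 1 ≤ p) {f g : X → ℝ} (hf : Measurable f) (hg : Measurable g) :
    ∫⁻ x, ‖f x + g x‖ₑ ^ p ∂ν ≤
      2 ^ (p - 1) * ((∫⁻ x, ‖f x‖ₑ ^ p ∂ν) + ∫⁻ x, ‖g x‖ₑ ^ p ∂ν) := by
  rw [← lintegral_add_left (by fun_prop), ← lintegral_const_mul _ (by fun_prop)]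
  refine lintegral_mono fun x => ?_
  refine le_trans ?_ (ENNReal.rpow_add_le_mul_rpow_add_rpow _ _ hp)
  gcongr
  exact enorm_add_le _ _

lemma energy_add_le (hp : 1 ≤ p) (hu : Measurable u) (hv : Measurable v) :
    energy Ω s p (fun x => u x + v x) ≤ 2 ^ (p - 1) * (energy Ω s p u + energy Ω s p v) := by
  have hp0 : 0 ≤ p := by linarith
  unfold energy
  rw [gagliardo_eq_lintegral hp0 hu, gagliardo_eq_lintegral hp0 hv,
    gagliardo_eq_lintegral hp0 (by fun_prop)]
  have h1 := lintegral_add_rpow_le (ν := volume.restrict Ω) hp hu hv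
  have h2 := lintegral_add_rpow_le (ν := gagliardoMeasure Ω s p) hp
    (f := fun z => u z.1 - u z.2) (g := fun z => v z.1 - v z.2) (by fun_prop) (by fun_prop)
  simp only [sub_add_sub_comm] at h2
  calc _ ≤ _ := add_le_add h1 h2
    _ = _ := by ring

lemma energy_neg (hp : 0 ≤ p) : energy Ω s p (fun x => -u x) = energy Ω s p u := by
  unfold energy
  rw [gagliardo_eq_lintegral_kernel hp, gagliardo_eq_lintegral_kernel hp]
  simp only [← neg_sub', enorm_neg]

lemma energy_sub_le (hp : 1 ≤ p) (hu : Measurable u) (hv : Measurable v) :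
    energy Ω s p (fun x => u x - v x) ≤ 2 ^ (p - 1) * (energy Ω s p u + energy Ω s p v) := by
  have := energy_add_le (Ω := Ω) (s := s) hp hu hv.neg
  simp only [Pi.neg_apply, ← sub_eq_add_neg] at this
  refine this.trans_eq ?_
  congr 2
  exact energy_neg (by linarith)

lemma ae_gagliardoMeasure {P Q : EuclideanSpace ℝ (Fin d) → Prop}
    (hP : ∀ᵐ x ∂(volume.restrict Ω), P x) (hQ : ∀ᵐ x ∂(volume.restrict Ω), Q x) :
    ∀ᵐ z ∂(gagliardoMeasure Ω s p), P z.1 ∧ Q z.2 := by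
  refine (withDensity_absolutelyContinuous _ _).ae_le ?_
  exact (Measure.quasiMeasurePreserving_fst.ae hP).and (Measure.quasiMeasurePreserving_snd.ae hQ)

lemma eventually_energy_add_le (hp : 1 < p) {g : EuclideanSpace ℝ (Fin d) → ℝ}
    {f : ℕ → EuclideanSpace ℝ (Fin d) → ℝ} (hg : Measurable g) (hf : ∀ j, Measurable (f j))
    {M : ℝ≥0∞} (hgp : energy Ω s p g ≠ ∞) (hfM : ∀ j, energy Ω s p (f j) ≤ M)
    (hlim : ∀ᵐ x ∂(volume.restrict Ω), Tendsto (fun j => f j x) atTop (𝓝 0)) :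
    ∀ᶠ j in atTop, energy Ω s p (fun x => g x + f j x) ≤ energy Ω s p g + (4 * M + 2) := by
  have hp0 : 0 ≤ p := by linarith
  have hgp' := ENNReal.add_ne_top.1 hgp
  have h1 := eventually_lintegral_add_rpow_le hp hg hf hgp'.1
    (fun j => le_self_add.trans (hfM j)) hlim
  have h2 := eventually_lintegral_add_rpow_le (ν := gagliardoMeasure Ω s p) hp
    (g := fun z => g z.1 - g z.2) (f := fun j z => f j z.1 - f j z.2) (M := M) (by fun_prop)
    (fun j => by have := hf j; fun_prop) (by rw [← gagliardo_eq_lintegral hp0 hg]; exact hgp'.2)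
    (fun j => by
      rw [← gagliardo_eq_lintegral hp0 (hf j)]
      exact le_add_self.trans (hfM j))
    (by
      filter_upwards [ae_gagliardoMeasure hlim hlim] with z hz
      simpa using hz.1.sub hz.2)
  filter_upwards [h1, h2] with j h1 h2
  have hfj := hf j
  unfold energy
  rw [gagliardo_eq_lintegral hp0 hg, gagliardo_eq_lintegral hp0 (by fun_prop)]
  simp only [sub_add_sub_comm] at h2
  calc _ ≤ _ := add_le_add h1 h2
    _ = _ := by ring

/-- A function which is the almost everywhere limit of a bounded sequence in a linear subspace of
`W^{s,p}(Ω)` belongs to the closure of the subspace. -/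
theorem exists_mem_energy_sub_lt (hp : 1 < p) (P : Submodule ℝ (EuclideanSpace ℝ (Fin d) → ℝ))
    (hP : ∀ v ∈ P, Measurable v) (hu : Measurable u) (huE : energy Ω s p u ≠ ∞)
    {f : ℕ → EuclideanSpace ℝ (Fin d) → ℝ} (hf : ∀ j, f j ∈ P) {M : ℝ≥0∞} (hM : M ≠ ∞)
    (hfM : ∀ j, energy Ω s p (f j) ≤ M)
    (hlim : ∀ᵐ x ∂(volume.restrict Ω), Tendsto (fun j => f j x) atTop (𝓝 (u x)))
    {ε : ℝ≥0∞} (hε : 0 < ε) :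
    ∃ v ∈ P, energy Ω s p (fun x => u x - v x) < ε := by
  have hp0 : 0 ≤ p := by linarith
  set M' : ℝ≥0∞ := 2 ^ (p - 1) * (M + energy Ω s p u) with hM'
  have hM'top : M' ≠ ∞ := ENNReal.mul_ne_top
    (ENNReal.rpow_ne_top_of_nonneg (by linarith) (by norm_num)) (ENNReal.add_ne_top.2 ⟨hM, huE⟩)
  set C : ℝ≥0∞ := 4 * M' + 2 with hC
  have hCtop : C ≠ ∞ := ENNReal.add_ne_top.2 ⟨ENNReal.mul_ne_top (by norm_num) hM'top, by norm_num⟩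
  -- `w` is a sum of `N` members of the sequence, chosen greedily: for `j` large, adding `f j - u`
  -- to the error raises its energy by at most `C`.
  have step : ∀ N : ℕ, ∃ w ∈ P, energy Ω s p (fun x => w x - N * u x) ≤ N * C := by
    intro N
    induction N with
    | zero =>
      refine ⟨0, P.zero_mem, ?_⟩
      simp [energy, gagliardo_eq_lintegral_kernel hp0, ENNReal.zero_rpow_of_pos (by linarith : 0 < p)]
    | succ N ih =>
      obtain ⟨w, hw, hwE⟩ := ih
      have hev := eventually_energy_add_le (Ω := Ω) (s := s) (M := M') hp
        (g := fun x => w x - N * u x) (f := fun j x => f j x - u x)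
        ((hP w hw).sub (hu.const_mul _)) (fun j => (hP _ (hf j)).sub hu)
        (ne_top_of_le_ne_top (ENNReal.mul_ne_top (by simp) hCtop) hwE)
        (fun j => (energy_sub_le hp.le (hP _ (hf j)) hu).trans (by rw [hM']; gcongr; exact hfM j))
        (by
          filter_upwards [hlim] with x hx
          simpa using hx.sub_const (u x))
      obtain ⟨j, hj⟩ := hev.exists
      refine ⟨w + f j, P.add_mem hw (hf j), ?_⟩
      have heq : (fun x => (w + f j) x - ((N + 1 : ℕ) : ℝ) * u x) =
          fun x => (w x - N * u x) + (f j x - u x) := by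
        ext x
        simp only [Pi.add_apply]
        push_cast
        ring
      rw [heq]
      refine hj.trans ?_
      push_cast
      rw [add_mul, one_mul]
      gcongr
  -- Division by `N` scales the energy by `N^(-p)`, which beats the linear growth because `p > 1`.
  have hlimN : Tendsto (fun N : ℕ => ENNReal.ofReal ((N : ℝ) ^ (1 - p)) * C) atTop (𝓝 0) := by
    have h1 : Tendsto (fun N : ℕ => (N : ℝ) ^ (1 - p)) atTop (𝓝 0) := by
      have := (tendsto_rpow_neg_atTop (by linarith : 0 < p - 1)).comp
        (tendsto_natCast_atTop_atTop (R := ℝ))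
      simpa [Function.comp_def] using this
    have h2 := (ENNReal.continuous_ofReal.tendsto _).comp h1
    simp only [ENNReal.ofReal_zero] at h2
    simpa using ENNReal.Tendsto.mul_const h2 (Or.inr hCtop)
  obtain ⟨N, hN, hN0⟩ := ((hlimN.eventually_lt_const hε).and (eventually_gt_atTop 0)).exists
  obtain ⟨w, hw, hwE⟩ := step N
  have hNR : (0 : ℝ) < N := by exact_mod_cast hN0
  refine ⟨(N : ℝ)⁻¹ • w, P.smul_mem _ hw, lt_of_le_of_lt ?_ hN⟩
  have heq : (fun x => u x - ((N : ℝ)⁻¹ • w) x) =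
      fun x => (-(N : ℝ)⁻¹) * (w x - N * u x) := by
    ext x
    simp only [Pi.smul_apply, smul_eq_mul]
    field_simp
    ring
  have hmeas : Measurable fun x => w x - N * u x := (hP w hw).sub (hu.const_mul _)
  rw [heq, energy_const_mul hp0 _ hmeas]
  calc ‖-(N : ℝ)⁻¹‖ₑ ^ p * energy Ω s p (fun x => w x - N * u x)
      ≤ ‖-(N : ℝ)⁻¹‖ₑ ^ p * (N * C) := by gcongr
    _ = ENNReal.ofReal ((N : ℝ) ^ (1 - p)) * C := by
        rw [← mul_assoc, enorm_rpow_eq_ofReal hp0, ← ENNReal.ofReal_natCast N,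
          ← ENNReal.ofReal_mul (by positivity), abs_neg, abs_of_pos (by positivity),
          Real.inv_rpow hNR.le, Real.rpow_sub hNR, Real.rpow_one, div_eq_inv_mul]

end Energy

/-! ### Lebesgue measure and Lipschitz maps -/

/-- Both measures are translation invariant. The value of `c` never matters, since it occurs on both
sides of the distortion bounds for Lipschitz maps. -/
lemma exists_volume_eq_smul_hausdorffMeasure (d : ℕ) :
    ∃ c : ℝ≥0, (volume : Measure (EuclideanSpace ℝ (Fin d))) = c • Measure.hausdorffMeasure d := by
  have h : ∃ n : ℕ, n = d ∧ ∃ c : ℝ≥0,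
      (volume : Measure (EuclideanSpace ℝ (Fin d))) = c • Measure.hausdorffMeasure n :=
    ⟨Module.finrank ℝ (EuclideanSpace ℝ (Fin d)), finrank_euclideanSpace_fin, _,
      Measure.isAddLeftInvariant_eq_smul _ _⟩
  obtain ⟨n, rfl, hc⟩ := h
  exact hc

lemma LipschitzOnWith.volume_image_le {d : ℕ} {L : ℝ≥0}
    {T : EuclideanSpace ℝ (Fin d) → EuclideanSpace ℝ (Fin d)} {A : Set (EuclideanSpace ℝ (Fin d))}
    (hT : LipschitzOnWith L T A) : volume (T '' A) ≤ (L : ℝ≥0∞) ^ d * volume A := by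
  obtain ⟨c, h⟩ := exists_volume_eq_smul_hausdorffMeasure d
  have h1 := hT.hausdorffMeasure_image_le (d := d) (by positivity)
  rw [ENNReal.rpow_natCast] at h1
  rw [h, Measure.smul_apply, Measure.smul_apply, mul_smul_comm]
  gcongr

lemma AntilipschitzWith.volume_preimage_le {d : ℕ} {L : ℝ≥0}
    {T : EuclideanSpace ℝ (Fin d) → EuclideanSpace ℝ (Fin d)} (hT : AntilipschitzWith L T)
    (A : Set (EuclideanSpace ℝ (Fin d))) :
    volume (T ⁻¹' A) ≤ (L : ℝ≥0∞) ^ d * volume A := by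
  obtain ⟨c, h⟩ := exists_volume_eq_smul_hausdorffMeasure d
  have h1 := hT.hausdorffMeasure_preimage_le (d := d) (by positivity) A
  rw [ENNReal.rpow_natCast] at h1
  rw [h, Measure.smul_apply, Measure.smul_apply, mul_smul_comm]
  gcongr

/-! ### Averages over balls of radius proportional to the distance from the complement of `Ω`. -/

section Mollification

variable {d : ℕ} {Ω : Set (EuclideanSpace ℝ (Fin d))} {s p : ℝ}
  {u : EuclideanSpace ℝ (Fin d) → ℝ}

/-- A change of variables without derivatives: the image under `T` of Lebesgue measure on `Ω` is at
most `L^d` times Lebesgue measure on `Ω`. -/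
lemma AntilipschitzWith.setLIntegral_comp_le {L : ℝ≥0}
    {T : EuclideanSpace ℝ (Fin d) → EuclideanSpace ℝ (Fin d)} (hT : AntilipschitzWith L T)
    (hTm : Measurable T) (hTΩ : Set.MapsTo T Ω Ω)
    {g : EuclideanSpace ℝ (Fin d) → ℝ≥0∞} (hg : Measurable g) :
    ∫⁻ x in Ω, g (T x) ≤ (L : ℝ≥0∞) ^ d * ∫⁻ x in Ω, g x := by
  rw [← lintegral_map hg hTm, ← smul_eq_mul, ← lintegral_smul_measure]
  refine lintegral_mono' (Measure.le_iff.2 fun A hA => ?_) le_rfl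
  rw [Measure.map_apply hTm hA, Measure.restrict_apply (hTm hA), Measure.smul_apply,
    Measure.restrict_apply hA, smul_eq_mul]
  refine le_trans (measure_mono ?_) (hT.volume_preimage_le (A ∩ Ω))
  exact fun x hx => ⟨hx.1, hTΩ hx.2⟩

lemma AntilipschitzWith.setLIntegral_setLIntegral_comp_le {L : ℝ≥0}
    {T : EuclideanSpace ℝ (Fin d) → EuclideanSpace ℝ (Fin d)} (hT : AntilipschitzWith L T)
    (hTm : Measurable T) (hTΩ : Set.MapsTo T Ω Ω)
    {G : EuclideanSpace ℝ (Fin d) → EuclideanSpace ℝ (Fin d) → ℝ≥0∞}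
    (hG : Measurable fun a : EuclideanSpace ℝ (Fin d) × EuclideanSpace ℝ (Fin d) => G a.1 a.2) :
    ∫⁻ x in Ω, ∫⁻ y in Ω, G (T x) (T y) ≤
      (L : ℝ≥0∞) ^ d * ((L : ℝ≥0∞) ^ d * ∫⁻ x in Ω, ∫⁻ y in Ω, G x y) := by
  calc ∫⁻ x in Ω, ∫⁻ y in Ω, G (T x) (T y)
      ≤ ∫⁻ x in Ω, (L : ℝ≥0∞) ^ d * ∫⁻ y in Ω, G (T x) y :=
        lintegral_mono fun x => hT.setLIntegral_comp_le hTm hTΩ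
          (g := fun y => G (T x) y) (hG.comp measurable_prodMk_left)
    _ = (L : ℝ≥0∞) ^ d * ∫⁻ x in Ω, ∫⁻ y in Ω, G (T x) y := by
        rw [lintegral_const_mul' _ _ (by simp)]
    _ ≤ _ := by
        gcongr
        exact hT.setLIntegral_comp_le hTm hTΩ (g := fun x => ∫⁻ y in Ω, G x y)
          hG.lintegral_prod_right'

lemma enorm_integral_rpow_le {X : Type*} [MeasurableSpace X] {π : Measure X}
    [IsProbabilityMeasure π] (hp : 1 ≤ p) {f : X → ℝ} (hf : Measurable f) :
    ‖∫ z, f z ∂π‖ₑ ^ p ≤ ∫⁻ z, ‖f z‖ₑ ^ p ∂π := by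
  have hp0 : 0 < p := by linarith
  have h1 := eLpNorm'_le_eLpNorm'_of_exponent_le (μ := π) zero_lt_one hp hf.aestronglyMeasurable
  simp only [eLpNorm', ENNReal.rpow_one, div_one] at h1
  calc ‖∫ z, f z ∂π‖ₑ ^ p ≤ ((∫⁻ z, ‖f z‖ₑ ^ p ∂π) ^ (1 / p)) ^ p := by
        gcongr
        exact (enorm_integral_le_lintegral_enorm f).trans h1
    _ = _ := by rw [← ENNReal.rpow_mul, one_div_mul_cancel hp0.ne', ENNReal.rpow_one]

/-- The uniform probability measure on the closed unit ball. -/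
def unitBallMeasure (d : ℕ) : Measure (EuclideanSpace ℝ (Fin d)) :=
  (volume.restrict (Metric.closedBall (0 : EuclideanSpace ℝ (Fin d)) 1) Set.univ)⁻¹ •
    volume.restrict (Metric.closedBall 0 1)

/-- The point `x + ε dist(x, ∂Ω) z`. -/
def shiftMap (Ω : Set (EuclideanSpace ℝ (Fin d))) (ε : ℝ) (z x : EuclideanSpace ℝ (Fin d)) :
    EuclideanSpace ℝ (Fin d) :=
  x + (ε * Metric.infDist x Ωᶜ) • z

/-- The average of `u` over the ball of centre `x` and radius `ε dist(x, ∂Ω)`. -/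
def localAverage (Ω : Set (EuclideanSpace ℝ (Fin d))) (u : EuclideanSpace ℝ (Fin d) → ℝ) (ε : ℝ)
    (x : EuclideanSpace ℝ (Fin d)) : ℝ :=
  ∫ z, u (shiftMap Ω ε z x) ∂(unitBallMeasure d)

lemma volume_unitBall_ne_zero :
    volume.restrict (Metric.closedBall (0 : EuclideanSpace ℝ (Fin d)) 1) Set.univ ≠ 0 := by
  rw [Measure.restrict_apply_univ]
  exact (Metric.measure_closedBall_pos _ _ one_pos).ne'

lemma volume_unitBall_ne_top :
    volume.restrict (Metric.closedBall (0 : EuclideanSpace ℝ (Fin d)) 1) Set.univ ≠ ∞ := by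
  rw [Measure.restrict_apply_univ]
  exact measure_closedBall_lt_top.ne

instance : IsProbabilityMeasure (unitBallMeasure d) := by
  refine ⟨?_⟩
  rw [unitBallMeasure, Measure.smul_apply, smul_eq_mul]
  exact ENNReal.inv_mul_cancel volume_unitBall_ne_zero volume_unitBall_ne_top

lemma ae_unitBallMeasure : ∀ᵐ z ∂(unitBallMeasure d), ‖z‖ ≤ 1 := by
  refine Measure.ae_smul_measure ?_ _
  filter_upwards [ae_restrict_mem Metric.isClosed_closedBall.measurableSet] with z hz
  simpa using hz

@[fun_prop]
lemma continuous_shiftMap {ε : ℝ} :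
    Continuous fun q : EuclideanSpace ℝ (Fin d) × EuclideanSpace ℝ (Fin d) =>
      shiftMap Ω ε q.1 q.2 := by
  unfold shiftMap
  have := Metric.continuous_infDist_pt (Ωᶜ)
  fun_prop

lemma measurable_localAverage (hu : Measurable u) (ε : ℝ) : Measurable (localAverage Ω u ε) := by
  refine StronglyMeasurable.measurable ?_
  refine StronglyMeasurable.integral_prod_right' (ν := unitBallMeasure d)
    (f := fun q : EuclideanSpace ℝ (Fin d) × EuclideanSpace ℝ (Fin d) =>
      u (shiftMap Ω ε q.2 q.1)) ?_
  refine (hu.comp ?_).stronglyMeasurable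
  have : Continuous fun q : EuclideanSpace ℝ (Fin d) × EuclideanSpace ℝ (Fin d) =>
      shiftMap Ω ε q.2 q.1 := continuous_shiftMap.comp continuous_swap
  exact this.measurable

/-- The distance to `Ωᶜ` is 1-Lipschitz, so the shift differs from the identity by a map of
Lipschitz constant at most `1/2`. Bi-Lipschitz bounds uniform in `z` and `ε` follow. -/
lemma norm_shiftMap_sub_sub_le {ε : ℝ} (hε : 0 ≤ ε) (hε' : ε ≤ 1 / 2)
    {z : EuclideanSpace ℝ (Fin d)} (hz : ‖z‖ ≤ 1) (x y : EuclideanSpace ℝ (Fin d)) :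
    ‖(shiftMap Ω ε z x - shiftMap Ω ε z y) - (x - y)‖ ≤ ‖x - y‖ / 2 := by
  have h1 : (shiftMap Ω ε z x - shiftMap Ω ε z y) - (x - y) =
      (ε * (Metric.infDist x Ωᶜ - Metric.infDist y Ωᶜ)) • z := by
    unfold shiftMap
    rw [mul_sub, sub_smul]
    abel
  have h2 : |Metric.infDist x Ωᶜ - Metric.infDist y Ωᶜ| ≤ ‖x - y‖ := by
    have := (Metric.lipschitz_infDist_pt Ωᶜ).dist_le_mul x y
    rwa [NNReal.coe_one, one_mul, Real.dist_eq, dist_eq_norm] at this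
  rw [h1, norm_smul, norm_mul, Real.norm_eq_abs, Real.norm_eq_abs, abs_of_nonneg hε]
  calc ε * |Metric.infDist x Ωᶜ - Metric.infDist y Ωᶜ| * ‖z‖ ≤ 1 / 2 * ‖x - y‖ * 1 := by gcongr
    _ = _ := by ring

lemma antilipschitzWith_shiftMap {ε : ℝ} (hε : 0 ≤ ε) (hε' : ε ≤ 1 / 2)
    {z : EuclideanSpace ℝ (Fin d)} (hz : ‖z‖ ≤ 1) : AntilipschitzWith 2 (shiftMap Ω ε z) := by
  refine AntilipschitzWith.of_le_mul_dist fun x y => ?_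
  have h1 := norm_shiftMap_sub_sub_le (Ω := Ω) hε hε' hz x y
  have h2 := norm_sub_norm_le (x - y) ((x - y) - (shiftMap Ω ε z x - shiftMap Ω ε z y))
  rw [sub_sub_cancel, norm_sub_rev (x - y)] at h2
  rw [dist_eq_norm, dist_eq_norm, NNReal.coe_ofNat]
  linarith

lemma norm_shiftMap_sub_le {ε : ℝ} (hε : 0 ≤ ε) (hε' : ε ≤ 1 / 2)
    {z : EuclideanSpace ℝ (Fin d)} (hz : ‖z‖ ≤ 1) (x y : EuclideanSpace ℝ (Fin d)) :
    ‖shiftMap Ω ε z x - shiftMap Ω ε z y‖ ≤ 2 * ‖x - y‖ := by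
  have h1 := norm_shiftMap_sub_sub_le (Ω := Ω) hε hε' hz x y
  have h2 := norm_sub_norm_le (shiftMap Ω ε z x - shiftMap Ω ε z y) (x - y)
  linarith [norm_nonneg (x - y)]

lemma infDist_compl_pos (hΩ : IsOpen Ω) (hΩ' : Ω ≠ Set.univ) {x : EuclideanSpace ℝ (Fin d)}
    (hx : x ∈ Ω) : 0 < Metric.infDist x Ωᶜ := by
  refine (hΩ.isClosed_compl.notMem_iff_infDist_pos ?_).1 (by simpa using hx)
  exact Set.nonempty_compl.2 hΩ'

lemma mapsTo_shiftMap (hΩ : IsOpen Ω) (hΩ' : Ω ≠ Set.univ) {ε : ℝ} (hε : 0 ≤ ε) (hε' : ε ≤ 1 / 2)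
    {z : EuclideanSpace ℝ (Fin d)} (hz : ‖z‖ ≤ 1) : Set.MapsTo (shiftMap Ω ε z) Ω Ω := by
  intro x hx
  by_contra h
  have h1 : Metric.infDist x Ωᶜ ≤ dist x (shiftMap Ω ε z x) := Metric.infDist_le_dist_of_mem h
  have h2 := infDist_compl_pos hΩ hΩ' hx
  rw [shiftMap, dist_self_add_right, norm_smul, norm_mul, Real.norm_eq_abs, Real.norm_eq_abs,
    abs_of_nonneg hε, abs_of_pos h2] at h1
  have h3 : ε * Metric.infDist x Ωᶜ * ‖z‖ ≤ 1 / 2 * Metric.infDist x Ωᶜ * 1 := by gcongr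
  linarith

lemma integrable_comp_shiftMap (hΩ : IsOpen Ω) (hΩ' : Ω ≠ Set.univ) (hu : Integrable u) {ε : ℝ}
    (hε : 0 < ε) {x : EuclideanSpace ℝ (Fin d)} (hx : x ∈ Ω) :
    Integrable (fun z => u (shiftMap Ω ε z x)) (unitBallMeasure d) := by
  refine Integrable.smul_measure ?_ (ENNReal.inv_ne_top.2 volume_unitBall_ne_zero)
  refine Integrable.integrableOn ?_
  have hρ : ε * Metric.infDist x Ωᶜ ≠ 0 := (mul_pos hε (infDist_compl_pos hΩ hΩ' hx)).ne'
  exact (hu.comp_add_left x).comp_smul hρ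

lemma lintegral_localAverage_rpow_le (hΩ : IsOpen Ω) (hΩ' : Ω ≠ Set.univ) (hp : 1 ≤ p)
    (hu : Measurable u) {ε : ℝ} (hε : 0 < ε) (hε' : ε ≤ 1 / 2) :
    ∫⁻ x in Ω, ‖localAverage Ω u ε x‖ₑ ^ p ≤ 2 ^ d * ∫⁻ x in Ω, ‖u x‖ₑ ^ p := by
  have hmeas : Measurable fun q : EuclideanSpace ℝ (Fin d) × EuclideanSpace ℝ (Fin d) =>
      ‖u (shiftMap Ω ε q.2 q.1)‖ₑ ^ p := by
    have := (hu.comp ((continuous_shiftMap (Ω := Ω) (ε := ε)).comp continuous_swap).measurable)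
    exact this.enorm.pow_const p
  calc ∫⁻ x in Ω, ‖localAverage Ω u ε x‖ₑ ^ p
      ≤ ∫⁻ x in Ω, (∫⁻ z, ‖u (shiftMap Ω ε z x)‖ₑ ^ p ∂(unitBallMeasure d)) := by
        refine lintegral_mono fun x => enorm_integral_rpow_le hp ?_
        exact hu.comp (continuous_shiftMap.comp (Continuous.prodMk_left x)).measurable
    _ = ∫⁻ z, (∫⁻ x in Ω, ‖u (shiftMap Ω ε z x)‖ₑ ^ p) ∂(unitBallMeasure d) :=
        lintegral_lintegral_swap hmeas.aemeasurable
    _ ≤ ∫⁻ _, (2 ^ d * ∫⁻ x in Ω, ‖u x‖ₑ ^ p) ∂(unitBallMeasure d) := by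
        refine lintegral_mono_ae ?_
        filter_upwards [ae_unitBallMeasure] with z hz
        exact (antilipschitzWith_shiftMap hε.le hε' hz).setLIntegral_comp_le
          (continuous_shiftMap.comp (Continuous.prodMk_right z)).measurable
          (mapsTo_shiftMap hΩ hΩ' hε.le hε' hz) (g := fun x => ‖u x‖ₑ ^ p) (by fun_prop)
    _ = _ := by simp

/-- Jensen and Tonelli reduce the bound to one shift by a fixed `z`. Such a shift at most doubles
distances, which costs `2^(d+sp)` in the kernel, and each change of variables costs `2^d`. -/
lemma gagliardo_localAverage_le (hΩ : IsOpen Ω) (hΩ' : Ω ≠ Set.univ) (hp : 1 ≤ p)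
    (hsp : 0 < (d : ℝ) + s * p) (hu : Measurable u) (hui : Integrable u) {ε : ℝ}
    (hε : 0 < ε) (hε' : ε ≤ 1 / 2) :
    gagliardo Ω s p (localAverage Ω u ε) ≤
      ENNReal.ofReal (2 ^ ((d : ℝ) + s * p)) * (2 ^ d * (2 ^ d * gagliardo Ω s p u)) := by
  have hp0 : 0 ≤ p := by linarith
  rw [gagliardo_eq_lintegral_kernel hp0, gagliardo_eq_lintegral_kernel hp0]
  set q := (d : ℝ) + s * p
  set w : EuclideanSpace ℝ (Fin d) → EuclideanSpace ℝ (Fin d) → ℝ≥0∞ :=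
    fun x y => ENNReal.ofReal (‖x - y‖ ^ q)⁻¹ with hw
  set G : EuclideanSpace ℝ (Fin d) → EuclideanSpace ℝ (Fin d) → ℝ≥0∞ :=
    fun x y => w x y * ‖u x - u y‖ₑ ^ p with hG
  have hwm : Measurable fun a : EuclideanSpace ℝ (Fin d) × EuclideanSpace ℝ (Fin d) =>
      w a.1 a.2 := by simp only [hw]; fun_prop
  have hGm : Measurable fun a : EuclideanSpace ℝ (Fin d) × EuclideanSpace ℝ (Fin d) =>
      G a.1 a.2 := by simp only [hG]; fun_prop
  have hΦ : ∀ z, Measurable (shiftMap Ω ε z) := fun z =>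
    (continuous_shiftMap.comp (Continuous.prodMk_right z)).measurable
  have hΦ' : Measurable fun a : EuclideanSpace ℝ (Fin d) × EuclideanSpace ℝ (Fin d) =>
      shiftMap Ω ε a.1 a.2 := continuous_shiftMap.measurable
  set H : (EuclideanSpace ℝ (Fin d) × EuclideanSpace ℝ (Fin d)) → EuclideanSpace ℝ (Fin d) → ℝ≥0∞ :=
    fun a z => w a.1 a.2 * ‖u (shiftMap Ω ε z a.1) - u (shiftMap Ω ε z a.2)‖ₑ ^ p with hH
  have hHm : Measurable (Function.uncurry H) := by
    have h1 : Measurable fun b : (EuclideanSpace ℝ (Fin d) × EuclideanSpace ℝ (Fin d)) ×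
        EuclideanSpace ℝ (Fin d) => u (shiftMap Ω ε b.2 b.1.1) :=
      hu.comp (hΦ'.comp (f := fun b : (EuclideanSpace ℝ (Fin d) × EuclideanSpace ℝ (Fin d)) ×
        EuclideanSpace ℝ (Fin d) => (b.2, b.1.1)) (by fun_prop))
    have h2 : Measurable fun b : (EuclideanSpace ℝ (Fin d) × EuclideanSpace ℝ (Fin d)) ×
        EuclideanSpace ℝ (Fin d) => u (shiftMap Ω ε b.2 b.1.2) :=
      hu.comp (hΦ'.comp (f := fun b : (EuclideanSpace ℝ (Fin d) × EuclideanSpace ℝ (Fin d)) ×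
        EuclideanSpace ℝ (Fin d) => (b.2, b.1.2)) (by fun_prop))
    exact (hwm.comp measurable_fst).mul ((h1.sub h2).enorm.pow_const p)
  have hz : ∀ z : EuclideanSpace ℝ (Fin d), ‖z‖ ≤ 1 →
      ∫⁻ x in Ω, ∫⁻ y in Ω, H (x, y) z ≤
        ENNReal.ofReal (2 ^ q) * (2 ^ d * (2 ^ d * ∫⁻ x in Ω, ∫⁻ y in Ω, G x y)) := by
    intro z hz
    have hL := antilipschitzWith_shiftMap (Ω := Ω) hε.le hε' hz
    have hmaps := mapsTo_shiftMap hΩ hΩ' hε.le hε' hz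
    have hpt : ∀ x y, H (x, y) z ≤
        ENNReal.ofReal (2 ^ q) * G (shiftMap Ω ε z x) (shiftMap Ω ε z y) := by
      intro x y
      simp only [hH, hG, ← mul_assoc]
      gcongr
      rcases eq_or_ne x y with rfl | hxy
      -- On the diagonal the kernel is `(0 ^ q)⁻¹ = 0`, because `q ≠ 0`.
      · simp [hw, Real.zero_rpow hsp.ne']
      · simp only [hw]
        rw [← ENNReal.ofReal_mul (by positivity)]
        refine ENNReal.ofReal_le_ofReal ?_
        have hne : 0 < ‖shiftMap Ω ε z x - shiftMap Ω ε z y‖ :=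
          norm_pos_iff.2 (sub_ne_zero.2 (hL.injective.ne hxy))
        rw [← div_eq_mul_inv, ← one_div, div_le_div_iff₀
          (Real.rpow_pos_of_pos (norm_pos_iff.2 (sub_ne_zero.2 hxy)) _)
          (Real.rpow_pos_of_pos hne _), one_mul, ← Real.mul_rpow (by norm_num) (norm_nonneg _)]
        exact Real.rpow_le_rpow hne.le (norm_shiftMap_sub_le hε.le hε' hz x y) hsp.le
    calc ∫⁻ x in Ω, ∫⁻ y in Ω, H (x, y) z
        ≤ ∫⁻ x in Ω, ∫⁻ y in Ω,
            ENNReal.ofReal (2 ^ q) * G (shiftMap Ω ε z x) (shiftMap Ω ε z y) :=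
          lintegral_mono fun x => lintegral_mono fun y => hpt x y
      _ = ENNReal.ofReal (2 ^ q) * ∫⁻ x in Ω, ∫⁻ y in Ω,
            G (shiftMap Ω ε z x) (shiftMap Ω ε z y) := by
          rw [← lintegral_const_mul' _ _ ENNReal.ofReal_ne_top]
          congr! 2 with x
          rw [← lintegral_const_mul' _ _ ENNReal.ofReal_ne_top]
      _ ≤ _ := by
          gcongr
          have := hL.setLIntegral_setLIntegral_comp_le (hΦ z) hmaps hGm
          rwa [ENNReal.coe_ofNat] at this
  calc ∫⁻ x in Ω, ∫⁻ y in Ω, w x y * ‖localAverage Ω u ε x - localAverage Ω u ε y‖ₑ ^ p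
      ≤ ∫⁻ x in Ω, ∫⁻ y in Ω, (∫⁻ z, H (x, y) z ∂(unitBallMeasure d)) := by
        refine setLIntegral_mono' hΩ.measurableSet fun x hx => ?_
        refine setLIntegral_mono' hΩ.measurableSet fun y hy => ?_
        simp only [hH]
        rw [lintegral_const_mul' _ _ ENNReal.ofReal_ne_top, localAverage, localAverage,
          ← integral_sub (integrable_comp_shiftMap hΩ hΩ' hui hε hx)
            (integrable_comp_shiftMap hΩ hΩ' hui hε hy)]
        gcongr
        refine enorm_integral_rpow_le hp (Measurable.sub ?_ ?_)
        · exact hu.comp (continuous_shiftMap.comp (Continuous.prodMk_left x)).measurable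
        · exact hu.comp (continuous_shiftMap.comp (Continuous.prodMk_left y)).measurable
    _ = ∫⁻ a, (∫⁻ z, H a z ∂(unitBallMeasure d)) ∂((volume.restrict Ω).prod (volume.restrict Ω)) := by
        exact (lintegral_prod (fun a => ∫⁻ z, H a z ∂(unitBallMeasure d))
          hHm.lintegral_prod_right'.aemeasurable).symm
    _ = ∫⁻ z, (∫⁻ a, H a z ∂((volume.restrict Ω).prod (volume.restrict Ω))) ∂(unitBallMeasure d) :=
        lintegral_lintegral_swap hHm.aemeasurable
    _ ≤ ∫⁻ _, (ENNReal.ofReal (2 ^ q) * (2 ^ d * (2 ^ d * ∫⁻ x in Ω, ∫⁻ y in Ω, G x y)))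
          ∂(unitBallMeasure d) := by
        refine lintegral_mono_ae ?_
        filter_upwards [ae_unitBallMeasure] with z hz'
        exact (lintegral_prod (fun a => H a z)
          (hHm.comp measurable_prodMk_right).aemeasurable).trans_le (hz z hz')
    _ = _ := by rw [lintegral_const, measure_univ, mul_one]

lemma energy_localAverage_le (hΩ : IsOpen Ω) (hΩ' : Ω ≠ Set.univ) (hp : 1 ≤ p)
    (hsp : 0 < (d : ℝ) + s * p) (hu : Measurable u) (hui : Integrable u) {ε : ℝ}
    (hε : 0 < ε) (hε' : ε ≤ 1 / 2) :
    energy Ω s p (localAverage Ω u ε) ≤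
      (2 ^ d + ENNReal.ofReal (2 ^ ((d : ℝ) + s * p)) * (2 ^ d * 2 ^ d)) * energy Ω s p u := by
  refine (add_le_add (lintegral_localAverage_rpow_le hΩ hΩ' hp hu hε hε')
    (gagliardo_localAverage_le hΩ hΩ' hp hsp hu hui hε hε')).trans ?_
  rw [add_mul, mul_assoc, mul_assoc]
  gcongr
  · exact le_self_add
  · exact le_add_self

/-- This moves the dependence on `x` from the argument of `u` to the ball, as needed for continuity
and for Lebesgue differentiation. -/
lemma localAverage_eq (hΩ : IsOpen Ω) (hΩ' : Ω ≠ Set.univ) (u : EuclideanSpace ℝ (Fin d) → ℝ)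
    {ε : ℝ} (hε : 0 < ε) {x : EuclideanSpace ℝ (Fin d)} (hx : x ∈ Ω) :
    localAverage Ω u ε x = ((ε * Metric.infDist x Ωᶜ) ^ d *
      volume.real (Metric.closedBall (0 : EuclideanSpace ℝ (Fin d)) 1))⁻¹ *
        ∫ y, (Metric.closedBall x (ε * Metric.infDist x Ωᶜ)).indicator u y := by
  set ρ := ε * Metric.infDist x Ωᶜ with hρ
  have hρ0 : 0 < ρ := mul_pos hε (infDist_compl_pos hΩ hΩ' hx)
  have h1 : ∀ z, (Metric.closedBall (0 : EuclideanSpace ℝ (Fin d)) 1).indicator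
      (fun z => u (x + ρ • z)) z = (Metric.closedBall x ρ).indicator u (x + ρ • z) := by
    intro z
    have : x + ρ • z ∈ Metric.closedBall x ρ ↔ z ∈ Metric.closedBall 0 1 := by
      rw [mem_closedBall_iff_norm, mem_closedBall_iff_norm, add_sub_cancel_left, norm_smul,
        Real.norm_eq_abs, abs_of_pos hρ0, sub_zero, mul_le_iff_le_one_right hρ0]
    by_cases h : z ∈ Metric.closedBall (0 : EuclideanSpace ℝ (Fin d)) 1
    · rw [Set.indicator_of_mem h, Set.indicator_of_mem (this.2 h)]
    · rw [Set.indicator_of_notMem h, Set.indicator_of_notMem (this.not.2 h)]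
  unfold localAverage unitBallMeasure shiftMap
  rw [integral_smul_measure, ← integral_indicator Metric.isClosed_closedBall.measurableSet]
  simp_rw [← hρ, h1]
  rw [Measure.integral_comp_smul volume
      (fun z => (Metric.closedBall x ρ).indicator u (x + z)) ρ,
    integral_add_left_eq_self (fun z => (Metric.closedBall x ρ).indicator u z) x,
    finrank_euclideanSpace_fin, Measure.restrict_apply_univ, ENNReal.toReal_inv, smul_eq_mul,
    smul_eq_mul, abs_of_pos (by positivity), mul_inv, ← Measure.real]
  ring

lemma localAverage_eq_average (hΩ : IsOpen Ω) (hΩ' : Ω ≠ Set.univ)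
    (u : EuclideanSpace ℝ (Fin d) → ℝ)
    {ε : ℝ} (hε : 0 < ε) {x : EuclideanSpace ℝ (Fin d)} (hx : x ∈ Ω) :
    localAverage Ω u ε x = ⨍ y in Metric.closedBall x (ε * Metric.infDist x Ωᶜ), u y := by
  have hρ0 : 0 < ε * Metric.infDist x Ωᶜ := mul_pos hε (infDist_compl_pos hΩ hΩ' hx)
  rw [localAverage_eq hΩ hΩ' u hε hx, setAverage_eq, smul_eq_mul,
    integral_indicator Metric.isClosed_closedBall.measurableSet, Measure.real, Measure.real,
    Measure.addHaar_closedBall' _ _ hρ0.le, finrank_euclideanSpace_fin, ENNReal.toReal_mul,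
    ENNReal.toReal_ofReal (by positivity)]

/-- Dominated convergence: the indicator of the moving ball is locally constant in the centre at
every `y` off the bounding sphere, which is a null set. -/
lemma continuousOn_localAverage (hΩ : IsOpen Ω) (hΩ' : Ω ≠ Set.univ) (hu : Integrable u)
    {ε : ℝ} (hε : 0 < ε) : ContinuousOn (localAverage Ω u ε) Ω := by
  refine ContinuousOn.congr ?_ fun x hx => localAverage_eq hΩ hΩ' u hε hx
  have hρc : Continuous fun x => ε * Metric.infDist x Ωᶜ :=
    continuous_const.mul (Metric.continuous_infDist_pt _)
  intro x hx
  refine ContinuousAt.continuousWithinAt ?_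
  have hρ0 : 0 < ε * Metric.infDist x Ωᶜ := mul_pos hε (infDist_compl_pos hΩ hΩ' hx)
  have hV : volume.real (Metric.closedBall (0 : EuclideanSpace ℝ (Fin d)) 1) ≠ 0 :=
    (ENNReal.toReal_pos (Metric.measure_closedBall_pos _ _ one_pos).ne'
      measure_closedBall_lt_top.ne).ne'
  refine ContinuousAt.mul (ContinuousAt.inv₀ (by fun_prop) (by positivity)) ?_
  refine continuousAt_of_dominated (bound := fun y => ‖u y‖) (Eventually.of_forall fun w =>
    (hu.indicator Metric.isClosed_closedBall.measurableSet).aestronglyMeasurable)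
    (Eventually.of_forall fun w => Eventually.of_forall fun y => norm_indicator_le_norm_self _ _)
    hu.norm ?_
  have hsphere : ∀ᵐ y : EuclideanSpace ℝ (Fin d),
      y ∉ Metric.sphere x (ε * Metric.infDist x Ωᶜ) :=
    measure_eq_zero_iff_ae_notMem.1 (Measure.addHaar_sphere_of_ne_zero _ _ hρ0.ne')
  filter_upwards [hsphere] with y hy
  have hd : Continuous fun w => dist y w := by fun_prop
  rcases lt_or_gt_of_ne hy with h | h
  · have hev : ∀ᶠ w in 𝓝 x, dist y w < ε * Metric.infDist w Ωᶜ :=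
      hd.continuousAt.eventually_lt hρc.continuousAt h
    refine continuousAt_const (y := u y) |>.congr ?_
    filter_upwards [hev] with w hw
    rw [Set.indicator_of_mem (Metric.mem_closedBall.2 hw.le)]
  · have hev : ∀ᶠ w in 𝓝 x, ε * Metric.infDist w Ωᶜ < dist y w :=
      hρc.continuousAt.eventually_lt hd.continuousAt h
    refine continuousAt_const (y := (0 : ℝ)) |>.congr ?_
    filter_upwards [hev] with w hw
    rw [Set.indicator_of_notMem (by simpa using hw)]

lemma ae_tendsto_localAverage (hΩ : IsOpen Ω) (hΩ' : Ω ≠ Set.univ) (hu : Integrable u)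
    {ε : ℕ → ℝ} (hε : ∀ j, 0 < ε j) (hlim : Tendsto ε atTop (𝓝 0)) :
    ∀ᵐ x ∂(volume.restrict Ω), Tendsto (fun j => localAverage Ω u (ε j) x) atTop (𝓝 (u x)) := by
  have h := IsUnifLocDoublingMeasure.ae_tendsto_average
    (μ := (volume : Measure (EuclideanSpace ℝ (Fin d)))) hu.locallyIntegrable 1
  filter_upwards [ae_restrict_of_ae h, ae_restrict_mem hΩ.measurableSet] with x hx hxΩ
  have hr := infDist_compl_pos hΩ hΩ' hxΩ
  refine (hx (fun _ => x) (fun j => ε j * Metric.infDist x Ωᶜ) ?_ ?_).congr fun j =>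
    (localAverage_eq_average hΩ hΩ' u (hε j) hxΩ).symm
  · refine tendsto_nhdsWithin_iff.2 ⟨?_, Eventually.of_forall fun j => mul_pos (hε j) hr⟩
    simpa using hlim.mul_const (Metric.infDist x Ωᶜ)
  · refine Eventually.of_forall fun j => Metric.mem_closedBall_self ?_
    have := mul_pos (hε j) hr
    linarith

end Mollification

/-! ### The model cylinder -/

section Cylinder

variable {d k : ℕ}

/-- The projection of `ℝ^d` onto the first `k` coordinates. -/
def headProj (d k : ℕ) : EuclideanSpace ℝ (Fin d) →ₗ[ℝ] EuclideanSpace ℝ (Fin d) where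
  toFun ξ := WithLp.toLp 2 fun i => if (i : ℕ) < k then ξ i else 0
  map_add' x y := by
    ext i
    by_cases h : (i : ℕ) < k <;> simp [h]
  map_smul' c x := by
    ext i
    by_cases h : (i : ℕ) < k <;> simp [h]

lemma headProj_apply (ξ : EuclideanSpace ℝ (Fin d)) (i : Fin d) :
    headProj d k ξ i = if (i : ℕ) < k then ξ i else 0 := rfl

lemma headNorm_eq (ξ : EuclideanSpace ℝ (Fin d)) : headNorm k ξ = ‖headProj d k ξ‖ := by
  rw [headNorm, EuclideanSpace.norm_eq]
  congr 2 with i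
  rw [headProj_apply]
  split_ifs <;> simp

lemma continuous_headNorm : Continuous (headNorm k : EuclideanSpace ℝ (Fin d) → ℝ) := by
  have h := (headProj d k).continuous_of_finiteDimensional
  rw [show (headNorm k : EuclideanSpace ℝ (Fin d) → ℝ) = fun ξ => ‖headProj d k ξ‖ from
    funext headNorm_eq]
  exact h.norm

lemma headNorm_nonneg (ξ : EuclideanSpace ℝ (Fin d)) : 0 ≤ headNorm k ξ := Real.sqrt_nonneg _

lemma abs_le_headNorm (ξ : EuclideanSpace ℝ (Fin d)) {i : Fin d} (hi : (i : ℕ) < k) :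
    |ξ i| ≤ headNorm k ξ := by
  have := PiLp.norm_apply_le (headProj d k ξ) i
  rwa [headProj_apply, if_pos hi, ← headNorm_eq] at this

lemma headNorm_eq_zero_iff {ξ : EuclideanSpace ℝ (Fin d)} :
    headNorm k ξ = 0 ↔ ∀ i : Fin d, (i : ℕ) < k → ξ i = 0 := by
  constructor
  · intro h i hi
    have := abs_le_headNorm ξ hi
    rw [h] at this
    exact abs_nonpos_iff.1 this
  · intro h
    rw [headNorm, Finset.sum_eq_zero, Real.sqrt_zero]
    intro i _
    split_ifs with hi
    · simp [h i hi]
    · rfl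

lemma isOpen_modelCylinder : IsOpen (modelCylinder d k) := by
  have : modelCylinder d k = {ξ | headNorm k ξ < 1} ∩
      ⋂ i : Fin d, ⋂ _ : k ≤ (i : ℕ), {ξ | 0 < ξ i ∧ ξ i < 1} := by
    ext ξ
    simp [modelCylinder]
  rw [this]
  refine (isOpen_lt continuous_headNorm continuous_const).inter ?_
  refine isOpen_iInter_of_finite fun i => isOpen_iInter_of_finite fun _ => ?_
  have hi : Continuous fun ξ : EuclideanSpace ℝ (Fin d) => ξ i := by fun_prop
  exact (isOpen_lt continuous_const hi).inter (isOpen_lt hi continuous_const)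

lemma convex_modelCylinder : Convex ℝ (modelCylinder d k) := by
  intro x hx y hy a b ha hb hab
  refine ⟨?_, fun i hi => convex_Ioo (0 : ℝ) 1 (hx.2 i hi) (hy.2 i hi) ha hb hab⟩
  have h1 : headNorm k (a • x + b • y) ≤ a * headNorm k x + b * headNorm k y := by
    rw [headNorm_eq, headNorm_eq, headNorm_eq, map_add, map_smul, map_smul]
    refine (norm_add_le _ _).trans_eq ?_
    rw [norm_smul, norm_smul, Real.norm_of_nonneg ha, Real.norm_of_nonneg hb]
  have h2 : a • headNorm k x + b • headNorm k y < 1 := convex_Iio (1 : ℝ) hx.1 hy.1 ha hb hab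
  exact h1.trans_lt h2

lemma volume_modelCylinder_inter_le (hkd : k ≤ d) (ρ : ℝ) :
    volume (modelCylinder d k ∩ {ξ | headNorm k ξ ≤ ρ}) ≤ ENNReal.ofReal (2 * ρ) ^ k := by
  set R : Fin d → Set ℝ := fun i => if (i : ℕ) < k then Set.Icc (-ρ) ρ else Set.Ioo 0 1 with hR
  have hsub : modelCylinder d k ∩ {ξ | headNorm k ξ ≤ ρ} ⊆
      (WithLp.ofLp : EuclideanSpace ℝ (Fin d) → Fin d → ℝ) ⁻¹' Set.univ.pi R := by
    intro ξ hξ i _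
    simp only [hR]
    split_ifs with hi
    · exact abs_le.1 ((abs_le_headNorm ξ hi).trans hξ.2)
    · exact hξ.1.2 i (not_lt.1 hi)
  have hRm : MeasurableSet (Set.univ.pi R) := by
    refine MeasurableSet.univ_pi fun i => ?_
    simp only [hR]
    split_ifs
    · exact measurableSet_Icc
    · exact measurableSet_Ioo
  refine (measure_mono hsub).trans ?_
  rw [(PiLp.volume_preserving_ofLp (Fin d)).measure_preimage
    hRm.nullMeasurableSet, volume_pi_pi]
  have : ∀ i : Fin d, volume (R i) = if (i : ℕ) < k then ENNReal.ofReal (2 * ρ) else 1 := by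
    intro i
    simp only [hR]
    split_ifs
    · rw [Real.volume_Icc]
      ring_nf
    · simp
  simp_rw [this]
  rw [Finset.prod_ite, Finset.prod_const, Finset.prod_const_one, mul_one,
    Fin.card_filter_val_lt, min_eq_right hkd]

lemma volume_modelCylinder_inter_eq_zero (hk : 0 < k) (hkd : k ≤ d) :
    volume (modelCylinder d k ∩ {ξ | headNorm k ξ = 0}) = 0 := by
  have := volume_modelCylinder_inter_le hkd 0
  rw [mul_zero, ENNReal.ofReal_zero, zero_pow hk.ne'] at this
  refine measure_mono_null ?_ (nonpos_iff_eq_zero.1 this)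
  exact fun ξ hξ => ⟨hξ.1, hξ.2.le⟩

lemma modelCylinder_subset_closure (hk : 0 < k) (hkd : k ≤ d) :
    modelCylinder d k ⊆ closure (modelCylinder d k ∩ {ξ | headNorm k ξ ≠ 0}) := by
  intro ξ hξ
  rw [mem_closure_iff]
  intro U hU hξU
  by_contra hne
  have hsub : U ∩ modelCylinder d k ⊆ modelCylinder d k ∩ {ξ | headNorm k ξ = 0} := by
    intro η hη
    refine ⟨hη.2, ?_⟩
    by_contra h
    exact hne ⟨η, hη.1, hη.2, h⟩
  exact (hU.inter isOpen_modelCylinder).measure_ne_zero volume ⟨ξ, hξU, hξ⟩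
    (measure_mono_null hsub (volume_modelCylinder_inter_eq_zero hk hkd))

lemma exists_headNorm_eq_zero_of_mem_segment {ξ η : EuclideanSpace ℝ (Fin d)}
    (hξ : ξ ∈ modelCylinder d k) (hη : η ∈ modelCylinder d k)
    (h : ¬ segment ℝ ξ η ⊆ modelCylinder d k ∩ {ξ | headNorm k ξ ≠ 0}) :
    ∃ a b : ℝ, 0 ≤ a ∧ 0 ≤ b ∧ a + b = 1 ∧ ∀ i : Fin d, (i : ℕ) < k → a * ξ i + b * η i = 0 := by
  obtain ⟨ζ, hζ, hζ'⟩ := Set.not_subset.1 h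
  have hζQ := convex_modelCylinder.segment_subset hξ hη hζ
  have hζ0 : headNorm k ζ = 0 := by
    by_contra h0
    exact hζ' ⟨hζQ, h0⟩
  obtain ⟨a, b, ha, hb, hab, rfl⟩ := hζ
  refine ⟨a, b, ha, hb, hab, fun i hi => ?_⟩
  simpa using headNorm_eq_zero_iff.1 hζ0 i hi

/-- The complement of a subspace of codimension at least two in the cylinder is connected. -/
lemma isPreconnected_modelCylinder_inter (hk : 1 < k) (hkd : k ≤ d) :
    IsPreconnected (modelCylinder d k ∩ {ξ | headNorm k ξ ≠ 0}) := by
  refine isPreconnected_of_forall_pair fun ξ hξ η hη => ?_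
  by_cases hseg : segment ℝ ξ η ⊆ modelCylinder d k ∩ {ξ | headNorm k ξ ≠ 0}
  · exact ⟨_, hseg, left_mem_segment ℝ ξ η, right_mem_segment ℝ ξ η,
      (convex_segment ξ η).isPreconnected⟩
  obtain ⟨a, b, ha, hb, hab, h0⟩ := exists_headNorm_eq_zero_of_mem_segment hξ.1 hη.1 hseg
  obtain ⟨i, hik, hi⟩ : ∃ i : Fin d, (i : ℕ) < k ∧ ξ i ≠ 0 := by
    by_contra! h
    exact hξ.2 (headNorm_eq_zero_iff.2 h)
  obtain ⟨i', hik', hi'⟩ : ∃ i : Fin d, (i : ℕ) < k ∧ η i ≠ 0 := by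
    by_contra! h
    exact hη.2 (headNorm_eq_zero_iff.2 h)
  have ha0 : a ≠ 0 := by
    rintro rfl
    have := h0 i' hik'
    simp only [zero_add] at hab
    simp [hab, hi'] at this
  have hb0 : b ≠ 0 := by
    rintro rfl
    have := h0 i hik
    simp only [add_zero] at hab
    simp [hab, hi] at this
  -- As `k ≥ 2`, there is a second head coordinate. Moving `ξ` slightly along it gives a point `ζ`
  -- through which the axis can be bypassed.
  obtain ⟨j, hjk, hji⟩ : ∃ j : Fin d, (j : ℕ) < k ∧ j ≠ i := by
    by_cases h : (i : ℕ) = 0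
    · exact ⟨⟨1, by omega⟩, hk, fun h' => by simp [← h'] at h⟩
    · exact ⟨⟨0, by omega⟩, by simp; omega, fun h' => h (by simp [← h'])⟩
  obtain ⟨c, hc0, hcQ⟩ : ∃ c : ℝ, c ≠ 0 ∧ ξ + c • EuclideanSpace.single j 1 ∈ modelCylinder d k := by
    have hcont : Continuous fun c : ℝ => ξ + c • EuclideanSpace.single j (1 : ℝ) := by fun_prop
    have hev : ∀ᶠ c in 𝓝 (0 : ℝ), ξ + c • EuclideanSpace.single j (1 : ℝ) ∈ modelCylinder d k := by
      refine hcont.continuousAt.eventually_mem (isOpen_modelCylinder.mem_nhds ?_)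
      simpa using hξ.1
    obtain ⟨c, hc⟩ := ((hev.filter_mono nhdsWithin_le_nhds).and
      (self_mem_nhdsWithin : {(0 : ℝ)}ᶜ ∈ 𝓝[≠] 0)).exists
    exact ⟨c, hc.2, hc.1⟩
  set ζ := ξ + c • EuclideanSpace.single j (1 : ℝ) with hζ
  have hζi : ζ i = ξ i := by simp [hζ, hji.symm]
  have hζj : ζ j = ξ j + c := by simp [hζ]
  have h1 : segment ℝ ξ ζ ⊆ modelCylinder d k ∩ {ξ | headNorm k ξ ≠ 0} := by
    by_contra hn
    obtain ⟨a', b', -, -, hab', h0'⟩ := exists_headNorm_eq_zero_of_mem_segment hξ.1 hcQ hn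
    have := h0' i hik
    rw [hζi, ← add_mul, hab', one_mul] at this
    exact hi this
  have h2 : segment ℝ ζ η ⊆ modelCylinder d k ∩ {ξ | headNorm k ξ ≠ 0} := by
    by_contra hn
    obtain ⟨a', b', -, -, hab', h0'⟩ := exists_headNorm_eq_zero_of_mem_segment hcQ hη.1 hn
    have e1 := h0' i hik
    have e2 := h0' j hjk
    rw [hζi] at e1
    rw [hζj] at e2
    have f1 := h0 i hik
    have f2 := h0 j hjk
    -- Coordinate `i` makes `(a', b')` proportional to `(a, b)`; coordinate `j`, where `ζ` and `ξ`
    -- differ by `c ≠ 0`, then forces `a' = 0`.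
    have g1 : (a' * b - b' * a) * ξ i = 0 := by linear_combination b * e1 - b' * f1
    have g1' := (mul_eq_zero.1 g1).resolve_right hi
    have g2 : a' * b * c = 0 := by linear_combination b * e2 - b' * f2 - ξ j * g1'
    have g3 : a' = 0 := by simpa [hb0, hc0] using g2
    rw [g3] at g1' hab'
    have g4 : b' = 1 := by linarith
    rw [g4] at g1'
    exact ha0 (by linarith)
  refine ⟨segment ℝ ξ ζ ∪ segment ℝ ζ η, Set.union_subset h1 h2,
    Or.inl (left_mem_segment ℝ ξ ζ), Or.inr (right_mem_segment ℝ ζ η), ?_⟩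
  exact IsPreconnected.union ζ (right_mem_segment ℝ ξ ζ) (left_mem_segment ℝ ζ η)
    (convex_segment ξ ζ).isPreconnected (convex_segment ζ η).isPreconnected

end Cylinder

/-! ### The volume of neighbourhoods of a Lipschitz set -/

section Volume

variable {d k : ℕ} {Ω K : Set (EuclideanSpace ℝ (Fin d))}

lemma lipschitzOnWith_of_lipNorm_le
    {f : EuclideanSpace ℝ (Fin d) → EuclideanSpace ℝ (Fin d)}
    {A : Set (EuclideanSpace ℝ (Fin d))} {C : ℝ≥0} (h : lipNorm f A ≤ C) :
    LipschitzOnWith C f A := by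
  intro x hx y hy
  rcases eq_or_ne x y with rfl | hxy
  · simp
  refine (ENNReal.div_le_iff (edist_pos.2 hxy).ne' (edist_ne_top x y)).1 ?_
  refine le_trans ?_ (le_add_self.trans h)
  exact le_iSup₂_of_le x hx (le_iSup₂_of_le (f := fun y (_ : y ∈ A) => edist (f x) (f y) / edist x y)
    y hy le_rfl)

/-- In a chart, `K` is either everything or contained in the axis `ξ_k = 0`. -/
lemma subset_or_inter_subset_image (hk : 1 < k) (hkd : k ≤ d) (hΩ : IsOpen Ω) (hK : IsClosed K)
    (hKΩ : K ⊆ Ω) {T : EuclideanSpace ℝ (Fin d) → EuclideanSpace ℝ (Fin d)}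
    {B : Set (EuclideanSpace ℝ (Fin d))} (hT : ContinuousOn T (modelCylinder d k))
    (hTB : Set.SurjOn T (modelCylinder d k) B) {c : ℝ} (hc : 0 < c)
    (hdist : ∀ ξ ∈ modelCylinder d k, T ξ ∈ Ω \ K → c * headNorm k ξ ≤ Metric.infDist (T ξ) K) :
    B ⊆ K ∨ ∀ ξ ∈ modelCylinder d k, T ξ ∈ K → headNorm k ξ = 0 := by
  set S := modelCylinder d k ∩ {ξ | headNorm k ξ ≠ 0} with hS
  have hSo : IsOpen S := isOpen_modelCylinder.inter
    (isOpen_ne_fun continuous_headNorm continuous_const)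
  have hTS : ContinuousOn T S := hT.mono Set.inter_subset_left
  -- At a point of `K` off the axis the distance to `K` is `0 < c * headNorm k ξ`. By continuity the
  -- lower bound fails nearby too, so nearby points cannot be in `Ω \ K`.
  have hu : IsOpen (S ∩ T ⁻¹' K) := by
    rw [isOpen_iff_mem_nhds]
    rintro ξ ⟨hξ, hξK⟩
    have hTξ : ContinuousAt T ξ := hTS.continuousAt (hSo.mem_nhds hξ)
    have h1 : ∀ᶠ η in 𝓝 ξ, T η ∈ Ω := hTξ.eventually_mem (hΩ.mem_nhds (hKΩ hξK))
    have h2 : ∀ᶠ η in 𝓝 ξ, Metric.infDist (T η) K < c * headNorm k η := by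
      refine ContinuousAt.eventually_lt
        ((Metric.continuous_infDist_pt K).continuousAt.comp hTξ)
        (continuous_const.mul continuous_headNorm).continuousAt ?_
      have hξ0 : Metric.infDist (T ξ) K = 0 := Metric.infDist_zero_of_mem hξK
      simp only [hξ0]
      exact mul_pos hc (lt_of_le_of_ne (headNorm_nonneg ξ) (Ne.symm hξ.2))
    filter_upwards [h1, h2, hSo.mem_nhds hξ] with η h1 h2 h3
    refine ⟨h3, ?_⟩
    by_contra h
    exact absurd (hdist η h3.1 ⟨h1, h⟩) (not_le.2 h2)
  have hv : IsOpen (S ∩ T ⁻¹' Kᶜ) := hTS.isOpen_inter_preimage hSo hK.isOpen_compl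
  by_cases hne : (S ∩ (S ∩ T ⁻¹' K)).Nonempty
  · left
    have hSK : ∀ ξ ∈ S, T ξ ∈ K := by
      intro ξ hξ
      by_contra h
      obtain ⟨η, -, hη1, hη2⟩ := isPreconnected_modelCylinder_inter hk hkd _ _ hu hv
        (fun ξ hξ => (em (T ξ ∈ K)).imp (fun h => ⟨hξ, h⟩) fun h => ⟨hξ, h⟩)
        hne ⟨ξ, hξ, hξ, h⟩
      exact hη2.2 hη1.2
    intro y hy
    obtain ⟨ξ, hξ, rfl⟩ := hTB hy
    -- The axis is null, hence `S` is dense in the cylinder, and `K` is closed.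
    have h1 : T ξ ∈ closure (T '' S) :=
      ((hT ξ hξ).mono Set.inter_subset_left).mem_closure_image
        (modelCylinder_subset_closure (by omega) hkd hξ)
    exact closure_minimal (Set.image_subset_iff.2 hSK) hK h1
  · right
    intro ξ hξ hξK
    by_contra h
    exact hne ⟨ξ, ⟨hξ, h⟩, ⟨hξ, h⟩, hξK⟩

/-- The gain over the definition is that the lower bound also holds at points of `K`. The
alternative that a chart ball lies inside `K` is ruled out by showing that `K` has empty interior.
-/
lemma IsLipschitzOfCodim.exists_chart (hk : 1 < k) (hkd : k < d) (hΩ : IsOpen Ω)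
    (hK : IsCompact K) (hKΩ : K ⊆ Ω) (h : IsLipschitzOfCodim Ω K k)
    {x : EuclideanSpace ℝ (Fin d)} (hx : x ∈ K) :
    ∃ r : ℝ, 0 < r ∧ ∃ (T : EuclideanSpace ℝ (Fin d) → EuclideanSpace ℝ (Fin d)) (L : ℝ≥0),
      LipschitzOnWith L T (modelCylinder d k) ∧
      Set.SurjOn T (modelCylinder d k) (Metric.ball x r) ∧ ∃ c : ℝ, 0 < c ∧
        ∀ ξ ∈ modelCylinder d k, T ξ ∈ Ω → c * headNorm k ξ ≤ Metric.infDist (T ξ) K := by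
  obtain ⟨C, -, h⟩ := h
  have key : ∀ x ∈ K, ∃ r : ℝ, 0 < r ∧
      ∃ (T : EuclideanSpace ℝ (Fin d) → EuclideanSpace ℝ (Fin d)),
        LipschitzOnWith C T (modelCylinder d k) ∧
        Set.SurjOn T (modelCylinder d k) (Metric.ball x r) ∧
        (∃ c : ℝ, 0 < c ∧ ∀ ξ ∈ modelCylinder d k, T ξ ∈ Ω \ K →
          c * headNorm k ξ ≤ Metric.infDist (T ξ) K) ∧
        (Metric.ball x r ⊆ K ∨ ∀ ξ ∈ modelCylinder d k, T ξ ∈ K → headNorm k ξ = 0) := by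
    intro x hx
    obtain ⟨r, hr, T, S, hbij, -, hlip, C₁, C₂, hC₁, -, hdist⟩ := h x hx
    have hT : LipschitzOnWith C T (modelCylinder d k) :=
      (lipschitzOnWith_of_lipNorm_le (le_self_add.trans hlip)).mono subset_closure
    have hd : ∀ ξ ∈ modelCylinder d k, T ξ ∈ Ω \ K → C₁ * headNorm k ξ ≤ Metric.infDist (T ξ) K :=
      fun ξ hξ hξK => (hdist ξ hξ hξK).1
    exact ⟨r, hr, T, hT, hbij.surjOn, ⟨C₁, hC₁, hd⟩,
      subset_or_inter_subset_image hk hkd.le hΩ hK.isClosed hKΩ hT.continuousOn hbij.surjOn hC₁ hd⟩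
  -- A nonempty interior has a boundary point `y`, as `K` is not the whole space. The chart ball at
  -- `y` is not contained in `K`, so `K` is null in it; yet this ball meets the open set `interior
  -- K`.
  have hint : interior K = ∅ := by
    by_contra hne
    have : Nonempty (Fin d) := ⟨⟨0, by omega⟩⟩
    have hneuniv : interior K ≠ Set.univ := by
      intro hu
      have : K = Set.univ := Set.univ_subset_iff.1 (hu ▸ interior_subset)
      exact (noncompact_univ (EuclideanSpace ℝ (Fin d))) (this ▸ hK)
    have hfr : (frontier (interior K)).Nonempty := by
      rw [Set.nonempty_iff_ne_empty, Ne, frontier_eq_empty_iff]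
      exact not_or.2 ⟨hne, hneuniv⟩
    obtain ⟨y, hy⟩ := hfr
    rw [isOpen_interior.frontier_eq] at hy
    have hyK : y ∈ K := closure_minimal interior_subset hK.isClosed hy.1
    obtain ⟨r, hr, T, hT, hTs, -, hor⟩ := key y hyK
    rcases hor with hB | hax
    · exact hy.2 (mem_interior.2 ⟨_, hB, Metric.isOpen_ball, Metric.mem_ball_self hr⟩)
    · obtain ⟨z, hz, hzK⟩ := mem_closure_iff.1 hy.1 _ Metric.isOpen_ball (Metric.mem_ball_self hr)
      refine (Metric.isOpen_ball.inter isOpen_interior).measure_ne_zero volume ⟨z, hz, hzK⟩ ?_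
      refine measure_mono_null
        (t := T '' (modelCylinder d k ∩ {ξ | headNorm k ξ = 0})) ?_ ?_
      · rintro w ⟨hw, hwK⟩
        obtain ⟨ξ, hξ, rfl⟩ := hTs hw
        exact ⟨ξ, ⟨hξ, hax ξ hξ (interior_subset hwK)⟩, rfl⟩
      · have := (hT.mono Set.inter_subset_left).volume_image_le
          (A := modelCylinder d k ∩ {ξ | headNorm k ξ = 0})
        rw [volume_modelCylinder_inter_eq_zero (by omega) hkd.le, mul_zero] at this
        exact nonpos_iff_eq_zero.1 this
  obtain ⟨r, hr, T, hT, hTs, ⟨c, hc, hd⟩, hor⟩ := key x hx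
  refine ⟨r, hr, T, C, hT, hTs, c, hc, fun ξ hξ hξΩ => ?_⟩
  rcases hor with hB | hax
  · have : x ∈ interior K := mem_interior.2 ⟨_, hB, Metric.isOpen_ball, Metric.mem_ball_self hr⟩
    rw [hint] at this
    exact this.elim
  · by_cases hξK : T ξ ∈ K
    · rw [hax ξ hξ hξK, mul_zero]
      exact Metric.infDist_nonneg
    · exact hd ξ hξ ⟨hξΩ, hξK⟩

/-- The `ρ`-neighbourhoods of a compact set of codimension `k` have volume `O(ρ^k)`. -/
theorem IsLipschitzOfCodim.exists_volume_thickening_le (hk : 1 < k) (hkd : k < d) (hΩ : IsOpen Ω)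
    (hK : IsCompact K) (hKΩ : K ⊆ Ω) (h : IsLipschitzOfCodim Ω K k) :
    ∃ C : ℝ≥0∞, C ≠ ∞ ∧ ∃ δ : ℝ, 0 < δ ∧ ∀ ρ : ℝ, ρ ≤ δ →
      volume (Metric.thickening ρ K) ≤ C * ENNReal.ofReal ρ ^ k := by
  have key : ∀ x ∈ K, ∃ r : ℝ, 0 < r ∧ ∃ C : ℝ≥0∞, C ≠ ∞ ∧ ∀ ρ : ℝ,
      volume (Metric.ball x r ∩ (Metric.thickening ρ K ∩ Ω)) ≤ C * ENNReal.ofReal ρ ^ k := by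
    intro x hx
    obtain ⟨r, hr, T, L, hT, hTs, c, hc, hd⟩ := h.exists_chart hk hkd hΩ hK hKΩ hx
    refine ⟨r, hr, L ^ d * ENNReal.ofReal (2 / c) ^ k,
      ENNReal.mul_ne_top (by simp) (by simp), fun ρ => ?_⟩
    have hsub : Metric.ball x r ∩ (Metric.thickening ρ K ∩ Ω) ⊆
        T '' (modelCylinder d k ∩ {ξ | headNorm k ξ ≤ ρ / c}) := by
      rintro y ⟨hy, hyρ, hyΩ⟩
      obtain ⟨ξ, hξ, rfl⟩ := hTs hy
      refine ⟨ξ, ⟨hξ, ?_⟩, rfl⟩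
      have h1 : Metric.infDist (T ξ) K < ρ := (Metric.mem_thickening_iff_infDist_lt ⟨x, hx⟩).1 hyρ
      rw [Set.mem_ofPred_eq, le_div_iff₀ hc, mul_comm]
      exact (hd ξ hξ hyΩ).trans h1.le
    calc _ ≤ volume (T '' (modelCylinder d k ∩ {ξ | headNorm k ξ ≤ ρ / c})) := measure_mono hsub
      _ ≤ L ^ d * volume (modelCylinder d k ∩ {ξ | headNorm k ξ ≤ ρ / c}) :=
          (hT.mono Set.inter_subset_left).volume_image_le
      _ ≤ L ^ d * ENNReal.ofReal (2 * (ρ / c)) ^ k := by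
          gcongr
          exact volume_modelCylinder_inter_le hkd.le _
      _ = _ := by
          rw [mul_assoc, ← mul_pow, ← ENNReal.ofReal_mul (by positivity)]
          congr 3
          ring
  choose! r hr C hC hvol using key
  obtain ⟨t, htK, hcov⟩ := hK.elim_nhds_subcover (fun x => Metric.ball x (r x))
    fun x hx => Metric.ball_mem_nhds x (hr x hx)
  -- Below the scale `δ` the neighbourhood stays in `Ω` and in the finitely many chart balls.
  obtain ⟨δ, hδ, hδU⟩ := hK.exists_thickening_subset_open
    ((isOpen_biUnion fun x (_ : x ∈ t) => Metric.isOpen_ball (x := x) (ε := r x)).inter hΩ)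
    (Set.subset_inter hcov hKΩ)
  refine ⟨∑ x ∈ t, C x, ENNReal.sum_ne_top.2 fun x hx => hC x (htK x hx), δ, hδ, fun ρ hρ => ?_⟩
  have hsub : Metric.thickening ρ K ⊆
      ⋃ x ∈ t, Metric.ball x (r x) ∩ (Metric.thickening ρ K ∩ Ω) := by
    intro y hy
    obtain ⟨h1, h2⟩ := hδU (Metric.thickening_mono hρ K hy)
    simp only [Set.mem_iUnion] at h1 ⊢
    obtain ⟨x, hx, hxy⟩ := h1
    exact ⟨x, hx, hxy, hy, h2⟩
  calc volume (Metric.thickening ρ K)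
      ≤ ∑ x ∈ t, volume (Metric.ball x (r x) ∩ (Metric.thickening ρ K ∩ Ω)) :=
        (measure_mono hsub).trans (measure_biUnion_finset_le _ _)
    _ ≤ ∑ x ∈ t, C x * ENNReal.ofReal ρ ^ k := Finset.sum_le_sum fun x hx => hvol x (htK x hx) ρ
    _ = _ := by rw [Finset.sum_mul]

end Volume

/-! ### Cutoff functions of bounded energy -/

section Cutoff

variable {d : ℕ} {κ p : ℝ}

/-- The kernel which dominates the energy density of a cutoff function at scale `ρ`. -/
def cutoffKernel (κ p ρ : ℝ) (z : EuclideanSpace ℝ (Fin d)) : ℝ≥0∞ :=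
  ENNReal.ofReal ((min 1 (2 * ‖z‖ / ρ)) ^ p / ‖z‖ ^ ((d : ℝ) + κ))

lemma measurable_cutoffKernel (ρ : ℝ) :
    Measurable (cutoffKernel κ p ρ : EuclideanSpace ℝ (Fin d) → ℝ≥0∞) := by
  unfold cutoffKernel
  fun_prop

/-- The integrand is at most `2^p y^(p-κ-1)` near zero, integrable as `κ < p`, and at most
`y^(-1-κ)` at infinity, integrable as `κ > 0`. -/
lemma integrableOn_cutoff_radial (hd : 0 < d) (hκ : 0 < κ) (hκp : κ < p) :
    IntegrableOn (fun y : ℝ => y ^ (d - 1) • ((min 1 (2 * y)) ^ p / y ^ ((d : ℝ) + κ)))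
      (Set.Ioi 0) := by
  have hmeas : Measurable fun y : ℝ => y ^ (d - 1) • ((min 1 (2 * y)) ^ p / y ^ ((d : ℝ) + κ)) := by
    fun_prop
  have hpow : ∀ y : ℝ, 0 < y → y ^ (d - 1) = y ^ ((d : ℝ) - 1) := by
    intro y hy
    rw [← Real.rpow_natCast, Nat.cast_sub hd, Nat.cast_one]
  rw [← Set.Ioc_union_Ioi_eq_Ioi zero_le_one, integrableOn_union]
  constructor
  · have hi : IntegrableOn (fun y : ℝ => 2 ^ p * y ^ (p - κ - 1)) (Set.Ioc 0 1) :=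
      ((intervalIntegrable_iff_integrableOn_Ioc_of_le zero_le_one).1
        (intervalIntegral.intervalIntegrable_rpow' (by linarith))).const_mul _
    refine Integrable.mono' hi hmeas.aestronglyMeasurable ?_
    refine (ae_restrict_mem measurableSet_Ioc).mono fun y hy => ?_
    have hy0 : 0 < y := hy.1
    rw [smul_eq_mul, Real.norm_of_nonneg (by positivity), hpow y hy0]
    calc y ^ ((d : ℝ) - 1) * (min 1 (2 * y) ^ p / y ^ ((d : ℝ) + κ))
        ≤ y ^ ((d : ℝ) - 1) * ((2 * y) ^ p / y ^ ((d : ℝ) + κ)) := by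
          have : 0 ≤ min 1 (2 * y) := by positivity
          gcongr
          · linarith
          · exact min_le_right _ _
      _ = 2 ^ p * (y ^ ((d : ℝ) - 1) * y ^ p / y ^ ((d : ℝ) + κ)) := by
          rw [Real.mul_rpow (by norm_num) hy0.le]
          ring
      _ = 2 ^ p * y ^ (p - κ - 1) := by
          rw [← Real.rpow_add hy0, ← Real.rpow_sub hy0]
          ring_nf
  · have hi : IntegrableOn (fun y : ℝ => y ^ (-1 - κ)) (Set.Ioi 1) :=
      integrableOn_Ioi_rpow_of_lt (by linarith) one_pos
    refine Integrable.mono' hi hmeas.aestronglyMeasurable ?_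
    refine (ae_restrict_mem measurableSet_Ioi).mono fun y hy => ?_
    have hy0 : 0 < y := lt_trans one_pos hy
    rw [smul_eq_mul, Real.norm_of_nonneg (by positivity), hpow y hy0]
    calc y ^ ((d : ℝ) - 1) * (min 1 (2 * y) ^ p / y ^ ((d : ℝ) + κ))
        ≤ y ^ ((d : ℝ) - 1) * (1 / y ^ ((d : ℝ) + κ)) := by
          have : 0 ≤ min 1 (2 * y) := by positivity
          gcongr
          exact Real.rpow_le_one this (min_le_left _ _) (by linarith)
      _ = y ^ (-1 - κ) := by
          rw [mul_one_div, ← Real.rpow_sub hy0]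
          ring_nf

lemma lintegral_cutoffKernel_one_lt_top (hd : 0 < d) (hκ : 0 < κ) (hκp : κ < p) :
    ∫⁻ z : EuclideanSpace ℝ (Fin d), cutoffKernel κ p 1 z < ∞ := by
  have : Nonempty (Fin d) := ⟨⟨0, hd⟩⟩
  have h := (integrable_fun_norm_addHaar (volume : Measure (EuclideanSpace ℝ (Fin d)))
    (f := fun y : ℝ => (min 1 (2 * y)) ^ p / y ^ ((d : ℝ) + κ))).2 (by
      rw [finrank_euclideanSpace_fin]
      exact integrableOn_cutoff_radial hd hκ hκp)
  simpa [cutoffKernel] using h.lintegral_lt_top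

/-- Scaling: the kernel contributes `ρ^(-d-κ)` and the Jacobian `ρ^d`. -/
lemma lintegral_cutoffKernel {ρ : ℝ} (hρ : 0 < ρ) :
    ∫⁻ z : EuclideanSpace ℝ (Fin d), cutoffKernel κ p ρ z =
      ENNReal.ofReal (ρ ^ (-κ)) * ∫⁻ z : EuclideanSpace ℝ (Fin d), cutoffKernel κ p 1 z := by
  have hpt : ∀ z : EuclideanSpace ℝ (Fin d), cutoffKernel κ p ρ z =
      ENNReal.ofReal (ρ ^ (-((d : ℝ) + κ))) * cutoffKernel κ p 1 (ρ⁻¹ • z) := by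
    intro z
    unfold cutoffKernel
    rw [← ENNReal.ofReal_mul (by positivity), norm_smul, Real.norm_of_nonneg (by positivity),
      Real.mul_rpow (by positivity) (norm_nonneg _), Real.inv_rpow hρ.le, Real.rpow_neg hρ.le]
    congr 1
    have h1 : 2 * (ρ⁻¹ * ‖z‖) / 1 = 2 * ‖z‖ / ρ := by field_simp
    have h2 : ρ ^ ((d : ℝ) + κ) ≠ 0 := by positivity
    rw [h1]
    field_simp
  simp_rw [hpt]
  rw [lintegral_const_mul' _ _ ENNReal.ofReal_ne_top,
    ← lintegral_map (f := cutoffKernel κ p 1) (measurable_cutoffKernel 1)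
      (measurable_const_smul ρ⁻¹), Measure.map_addHaar_smul _ (inv_ne_zero hρ.ne'),
    lintegral_smul_measure, smul_eq_mul, ← mul_assoc, ← ENNReal.ofReal_mul (by positivity),
    finrank_euclideanSpace_fin, inv_pow, inv_inv, abs_of_pos (by positivity),
    ← Real.rpow_natCast, ← Real.rpow_add hρ]
  congr 3
  ring

/-- A pair contributes only if one of its points lies in `A`; the other variable is integrated over
the whole space. The two cases give the factor `2`. -/
lemma gagliardo_cutoff_le {Ω A : Set (EuclideanSpace ℝ (Fin d))} (hA : MeasurableSet A) {s : ℝ}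
    (hp : 0 < p) {ρ : ℝ} (hρ : 0 < ρ) {ψ : EuclideanSpace ℝ (Fin d) → ℝ}
    (h0 : ∀ x, 0 ≤ ψ x) (h1 : ∀ x, ψ x ≤ 1)
    (hL : ∀ x y, |ψ x - ψ y| ≤ 2 * ‖x - y‖ / ρ) (hψA : ∀ x, x ∉ A → ψ x = 0) :
    gagliardo Ω s p ψ ≤
      2 * volume A * (ENNReal.ofReal (ρ ^ (-(s * p))) *
        ∫⁻ z : EuclideanSpace ℝ (Fin d), cutoffKernel (s * p) p 1 z) := by
  rw [← lintegral_cutoffKernel hρ]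
  set J : EuclideanSpace ℝ (Fin d) → ℝ≥0∞ := cutoffKernel (s * p) p ρ with hJ
  have hJm : Measurable J := measurable_cutoffKernel ρ
  set χ : EuclideanSpace ℝ (Fin d) → ℝ≥0∞ := A.indicator 1 with hχ
  have hχm : Measurable χ := measurable_one.indicator hA
  have hJsymm : ∀ x y, J (x - y) = J (y - x) := fun x y => by
    simp only [hJ, cutoffKernel, norm_sub_rev x y]
  have hpt : ∀ x y, ENNReal.ofReal (|ψ x - ψ y| ^ p / ‖x - y‖ ^ ((d : ℝ) + s * p)) ≤
      χ x * J (y - x) + χ y * J (x - y) := by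
    intro x y
    have hle : ENNReal.ofReal (|ψ x - ψ y| ^ p / ‖x - y‖ ^ ((d : ℝ) + s * p)) ≤ J (x - y) := by
      refine ENNReal.ofReal_le_ofReal ?_
      gcongr
      refine le_min ?_ (hL x y)
      rw [abs_le]
      constructor <;> linarith [h0 x, h1 x, h0 y, h1 y]
    by_cases hx : x ∈ A
    · refine hle.trans (le_add_right ?_)
      simp [hχ, hx, hJsymm x y]
    · by_cases hy : y ∈ A
      · refine hle.trans (le_add_left ?_)
        simp [hχ, hy]
      · simp [hψA x hx, hψA y hy, Real.zero_rpow hp.ne']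
  have hint : ∀ x, ∫⁻ y, J (y - x) = ∫⁻ z, J z := fun x => lintegral_sub_right_eq_self J x
  have hχA : ∫⁻ x, χ x = volume A := by rw [hχ, lintegral_indicator_one hA]
  have hm1 : Measurable fun q : EuclideanSpace ℝ (Fin d) × EuclideanSpace ℝ (Fin d) =>
      χ q.1 * J (q.2 - q.1) := by fun_prop
  have hm2 : Measurable fun q : EuclideanSpace ℝ (Fin d) × EuclideanSpace ℝ (Fin d) =>
      χ q.2 * J (q.1 - q.2) := by fun_prop
  have e1 : ∫⁻ x, ∫⁻ y, χ x * J (y - x) = volume A * ∫⁻ z, J z := by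
    have : ∀ x, ∫⁻ y, χ x * J (y - x) = χ x * ∫⁻ z, J z := fun x => by
      rw [lintegral_const_mul _ (by fun_prop), hint]
    simp_rw [this]
    rw [lintegral_mul_const _ hχm, hχA]
  calc gagliardo Ω s p ψ ≤ ∫⁻ x in Ω, ∫⁻ y in Ω, (χ x * J (y - x) + χ y * J (x - y)) :=
        lintegral_mono fun x => lintegral_mono fun y => hpt x y
    _ ≤ ∫⁻ x, ∫⁻ y, (χ x * J (y - x) + χ y * J (x - y)) :=
        (setLIntegral_le_lintegral _ _).trans
          (lintegral_mono fun x => setLIntegral_le_lintegral _ _)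
    _ = (∫⁻ x, ∫⁻ y, χ x * J (y - x)) + ∫⁻ x, ∫⁻ y, χ y * J (x - y) := by
        rw [← lintegral_add_left hm1.lintegral_prod_right']
        congr! 2 with x
        exact lintegral_add_left (hm1.comp measurable_prodMk_left) _
    _ = 2 * volume A * ∫⁻ z, J z := by
        rw [lintegral_lintegral_swap hm2.aemeasurable (f := fun x y => χ y * J (x - y)), e1,
          two_mul, add_mul]

end Cutoff

/-- The continuous function which equals `1` on the `ρ/2`-neighbourhood of `K` and `0` outside the
`ρ`-neighbourhood. -/
def cutoff {d : ℕ} (K : Set (EuclideanSpace ℝ (Fin d))) (ρ : ℝ) (x : EuclideanSpace ℝ (Fin d)) :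
    ℝ :=
  max 0 (min 1 (2 - 2 * Metric.infDist x K / ρ))

section

variable {d : ℕ} {K : Set (EuclideanSpace ℝ (Fin d))} {ρ : ℝ}

lemma continuous_cutoff : Continuous (cutoff K ρ) := by
  unfold cutoff
  have := Metric.continuous_infDist_pt K
  fun_prop

lemma abs_cutoff_sub_le (hρ : 0 < ρ) (x y : EuclideanSpace ℝ (Fin d)) :
    |cutoff K ρ x - cutoff K ρ y| ≤ 2 * ‖x - y‖ / ρ := by
  have h2 : |Metric.infDist y K - Metric.infDist x K| ≤ ‖x - y‖ := by
    have := (Metric.lipschitz_infDist_pt K).dist_le_mul y x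
    rwa [NNReal.coe_one, one_mul, Real.dist_eq, dist_eq_norm, norm_sub_rev] at this
  unfold cutoff
  calc _ ≤ |min 1 (2 - 2 * Metric.infDist x K / ρ) - min 1 (2 - 2 * Metric.infDist y K / ρ)| := by
        simpa using abs_max_sub_max_le_max (0 : ℝ) (min 1 (2 - 2 * Metric.infDist x K / ρ)) 0
          (min 1 (2 - 2 * Metric.infDist y K / ρ))
    _ ≤ |(2 - 2 * Metric.infDist x K / ρ) - (2 - 2 * Metric.infDist y K / ρ)| := by
        simpa using abs_min_sub_min_le_max (1 : ℝ) (2 - 2 * Metric.infDist x K / ρ) 1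
          (2 - 2 * Metric.infDist y K / ρ)
    _ = 2 * |Metric.infDist y K - Metric.infDist x K| / ρ := by
        rw [show (2 - 2 * Metric.infDist x K / ρ) - (2 - 2 * Metric.infDist y K / ρ) =
          2 * (Metric.infDist y K - Metric.infDist x K) / ρ by ring, abs_div, abs_mul,
          abs_of_pos hρ, abs_two]
    _ ≤ _ := by gcongr

lemma cutoff_eq_zero (hρ : 0 < ρ) {x : EuclideanSpace ℝ (Fin d)} (hx : ρ ≤ Metric.infDist x K) :
    cutoff K ρ x = 0 := by
  have : 1 ≤ Metric.infDist x K / ρ := by rwa [le_div_iff₀ hρ, one_mul]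
  unfold cutoff
  refine max_eq_left ((min_le_right _ _).trans ?_)
  rw [mul_div_assoc]
  linarith

lemma cutoff_eq_one (hρ : 0 < ρ) {x : EuclideanSpace ℝ (Fin d)} (hx : Metric.infDist x K ≤ ρ / 2) :
    cutoff K ρ x = 1 := by
  have : Metric.infDist x K / ρ ≤ 1 / 2 := by
    rw [div_le_iff₀ hρ]
    linarith
  unfold cutoff
  rw [min_eq_left, max_eq_right zero_le_one]
  rw [mul_div_assoc]
  linarith

end

/-- A compact set of codimension `k = sp` has zero capacity in a weak sense: there are cutoff
functions of bounded energy that tend to zero almost everywhere. -/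
theorem IsLipschitzOfCodim.exists_cutoff {d k : ℕ} {Ω K : Set (EuclideanSpace ℝ (Fin d))}
    (hk : 1 < k) (hkd : k < d) {s p : ℝ} (hkp : (k : ℝ) < p) (hsp : s * p = k)
    (hΩ : IsOpen Ω) (hK : IsCompact K) (hKΩ : K ⊆ Ω) (h : IsLipschitzOfCodim Ω K k) :
    ∃ M : ℝ≥0∞, M ≠ ∞ ∧ ∃ ψ : ℕ → EuclideanSpace ℝ (Fin d) → ℝ,
      (∀ j, Continuous (ψ j)) ∧ (∀ j x, 0 ≤ ψ j x ∧ ψ j x ≤ 1) ∧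
      (∀ j, ∀ᶠ x in 𝓝ˢ K, ψ j x = 1) ∧ (∀ j, gagliardo Ω s p (ψ j) ≤ M) ∧
      ∀ᵐ x, Tendsto (fun j => ψ j x) atTop (𝓝 0) := by
  have hk0 : (0 : ℝ) < k := by positivity
  have hp : 0 < p := hk0.trans hkp
  -- For empty `K`, `Metric.infDist` is `0` by convention and `cutoff` would be constantly `1`, so
  -- zero functions are used instead.
  rcases K.eq_empty_or_nonempty with rfl | hne
  · refine ⟨0, ENNReal.zero_ne_top, fun _ _ => 0, fun _ => continuous_const, ?_, ?_, ?_, ?_⟩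
    · simp
    · simp
    · simp [gagliardo, Real.zero_rpow hp.ne']
    · simp
  obtain ⟨C, hC, δ, hδ, hvol⟩ := h.exists_volume_thickening_le hk hkd hΩ hK hKΩ
  set ρ : ℕ → ℝ := fun j => δ / (j + 1) with hρ
  have hρ0 : ∀ j, 0 < ρ j := fun j => by positivity
  have hρδ : ∀ j, ρ j ≤ δ := fun j => div_le_self hδ.le (by linarith [j.cast_nonneg (α := ℝ)])
  have hρlim : Tendsto ρ atTop (𝓝 0) := by
    have := tendsto_one_div_add_atTop_nhds_zero_nat (𝕜 := ℝ) |>.const_mul δ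
    simpa [hρ, div_eq_mul_inv] using this
  have hKnull : volume K = 0 := by
    have h1 : Tendsto (fun j => C * ENNReal.ofReal (ρ j) ^ k) atTop (𝓝 0) := by
      have h2 := (ENNReal.continuous_ofReal.tendsto _).comp hρlim
      have h3 := ((ENNReal.continuous_pow k).tendsto _).comp h2
      have h4 := ENNReal.Tendsto.const_mul h3 (Or.inr hC)
      simpa [zero_pow (by omega : k ≠ 0), Function.comp_def] using h4
    refine nonpos_iff_eq_zero.1 (ge_of_tendsto' h1 fun j => ?_)
    exact (measure_mono (Metric.self_subset_thickening (hρ0 j) K)).trans (hvol _ (hρδ j))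
  refine ⟨2 * C * ∫⁻ z : EuclideanSpace ℝ (Fin d), cutoffKernel (s * p) p 1 z, ?_,
    fun j => cutoff K (ρ j), fun j => continuous_cutoff, ?_, ?_, ?_, ?_⟩
  · refine ENNReal.mul_ne_top (ENNReal.mul_ne_top (by norm_num) hC) ?_
    exact (lintegral_cutoffKernel_one_lt_top (by omega) (hsp ▸ hk0) (hsp ▸ hkp)).ne
  · exact fun j x => ⟨le_max_left _ _, max_le zero_le_one (min_le_left _ _)⟩
  · intro j
    have : Metric.thickening (ρ j / 2) K ∈ 𝓝ˢ K := Metric.isOpen_thickening.mem_nhdsSet.2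
      (Metric.self_subset_thickening (half_pos (hρ0 j)) K)
    filter_upwards [this] with x hx
    exact cutoff_eq_one (hρ0 j) ((Metric.mem_thickening_iff_infDist_lt hne).1 hx).le
  · intro j
    refine (gagliardo_cutoff_le (A := Metric.thickening (ρ j) K)
      Metric.isOpen_thickening.measurableSet hp (hρ0 j) (fun x => le_max_left _ _)
      (fun x => max_le zero_le_one (min_le_left _ _)) (abs_cutoff_sub_le (hρ0 j)) ?_).trans ?_
    · intro x hx
      refine cutoff_eq_zero (hρ0 j) (not_lt.1 fun h => hx ?_)
      exact (Metric.mem_thickening_iff_infDist_lt hne).2 h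
    · rw [← mul_assoc]
      gcongr ?_ * _
      calc 2 * volume (Metric.thickening (ρ j) K) * ENNReal.ofReal (ρ j ^ (-(s * p)))
          ≤ 2 * (C * ENNReal.ofReal (ρ j) ^ k) * ENNReal.ofReal (ρ j ^ (-(s * p))) := by
            gcongr
            exact hvol _ (hρδ j)
        _ = 2 * C * ENNReal.ofReal (ρ j ^ k * ρ j ^ (-(s * p))) := by
            rw [ENNReal.ofReal_mul (by have := hρ0 j; positivity),
              ENNReal.ofReal_pow (hρ0 j).le]
            ring
        -- Here `sp = k` is decisive: the powers of `ρ j` cancel.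
        _ = 2 * C := by
            rw [hsp, ← Real.rpow_natCast, ← Real.rpow_add (hρ0 j), add_neg_cancel, Real.rpow_zero,
              ENNReal.ofReal_one, mul_one]
  · filter_upwards [measure_eq_zero_iff_ae_notMem.1 hKnull] with x hx
    have hpos : 0 < Metric.infDist x K := (hK.isClosed.notMem_iff_infDist_pos hne).1 hx
    refine tendsto_const_nhds.congr' ?_
    filter_upwards [hρlim.eventually_lt_const hpos] with j hj
    exact (cutoff_eq_zero (hρ0 j) hj.le).symm

/-! ### Truncation -/

/-- The truncation of `a` to the interval `[-h, h]`. -/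
def clip (a h : ℝ) : ℝ := max (-h) (min a h)

lemma continuous_clip : Continuous fun q : ℝ × ℝ => clip q.1 q.2 := by
  unfold clip
  fun_prop

lemma abs_clip_le {a h : ℝ} (hh : 0 ≤ h) : |clip a h| ≤ |a| := by
  unfold clip
  rcases le_total a h with h1 | h1
  · rw [min_eq_left h1]
    rcases le_total (-h) a with h2 | h2
    · rw [max_eq_right h2]
    · rw [max_eq_left h2, abs_neg, abs_of_nonneg hh]
      linarith [neg_le_abs a]
  · rw [min_eq_right h1, max_eq_right (by linarith), abs_of_nonneg hh]
    exact h1.trans (le_abs_self a)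

lemma clip_eq_self {a h : ℝ} (ha : |a| ≤ h) : clip a h = a := by
  obtain ⟨h1, h2⟩ := abs_le.1 ha
  rw [clip, min_eq_left h2, max_eq_right h1]

lemma clip_zero_right (a : ℝ) : clip a 0 = 0 := by
  simp [clip]

/-- This replaces the product rule: an increment of the clipped function is controlled by that of
the function or that of the height, so the `p`-th powers simply add. -/
lemma abs_clip_sub_clip_le (a b g h : ℝ) : |clip a g - clip b h| ≤ max |a - b| |g - h| := by
  unfold clip
  refine (abs_max_sub_max_le_max _ _ _ _).trans (max_le ?_ (abs_min_sub_min_le_max _ _ _ _))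
  rw [neg_sub_neg, abs_sub_comm]
  exact le_max_right _ _

lemma abs_sub_clip_sub_le {h : ℝ} (hh : 0 ≤ h) (a b : ℝ) :
    |(a - clip a h) - (b - clip b h)| ≤ |a - b| := by
  unfold clip
  rcases le_total a h with h1 | h1 <;> rcases le_total b h with h2 | h2 <;>
  rcases le_total (-h) a with h3 | h3 <;> rcases le_total (-h) b with h4 | h4 <;>
  simp only [min_eq_left, min_eq_right, max_eq_left, max_eq_right, h1, h2, h3, h4,
    neg_le_self hh] <;>
  exact abs_le.2 ⟨by linarith [neg_abs_le (a - b), le_abs_self (a - b), abs_nonneg (a - b)],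
    by linarith [neg_abs_le (a - b), le_abs_self (a - b), abs_nonneg (a - b)]⟩

section

variable {d : ℕ} {Ω K : Set (EuclideanSpace ℝ (Fin d))} {s p : ℝ}
  {u v h : EuclideanSpace ℝ (Fin d) → ℝ}

lemma energy_clip_le (hp : 0 ≤ p) (hu : Measurable u) (hhm : Measurable h) (hh : ∀ x, 0 ≤ h x) :
    energy Ω s p (fun x => clip (u x) (h x)) ≤ energy Ω s p u + gagliardo Ω s p h := by
  have hcm : Measurable fun x => clip (u x) (h x) :=
    continuous_clip.measurable.comp (hu.prodMk hhm)
  unfold energy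
  rw [add_assoc, gagliardo_eq_lintegral hp hu, gagliardo_eq_lintegral hp hhm,
    gagliardo_eq_lintegral hp hcm, ← lintegral_add_left (by fun_prop)]
  refine add_le_add (lintegral_mono fun x => ?_) (lintegral_mono fun z => ?_)
  · gcongr
    exact enorm_le_iff_norm_le.2 (abs_clip_le (hh x))
  · rcases le_max_iff.1 (abs_clip_sub_clip_le (u z.1) (u z.2) (h z.1) (h z.2)) with h1 | h1
    · refine le_add_right ?_
      gcongr
      exact enorm_le_iff_norm_le.2 h1
    · refine le_add_left ?_
      gcongr
      exact enorm_le_iff_norm_le.2 h1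

lemma tendsto_lintegral_rpow_of_dominated {X : Type*} [MeasurableSpace X] {ν : Measure X}
    (hp : 0 < p) {f : ℕ → X → ℝ} {g : X → ℝ} (hf : ∀ j, Measurable (f j))
    (hg : ∫⁻ x, ‖g x‖ₑ ^ p ∂ν ≠ ∞) (hfg : ∀ j x, |f j x| ≤ |g x|)
    (hlim : ∀ x, ∀ᶠ j in atTop, f j x = 0) :
    Tendsto (fun j => ∫⁻ x, ‖f j x‖ₑ ^ p ∂ν) atTop (𝓝 0) := by
  have h := tendsto_lintegral_of_dominated_convergence (μ := ν) (F := fun j x => ‖f j x‖ₑ ^ p)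
    (f := fun _ => 0) (fun x => ‖g x‖ₑ ^ p) (fun j => by have := hf j; fun_prop)
    (fun j => Eventually.of_forall fun x => by
      dsimp only
      gcongr
      exact enorm_le_iff_norm_le.2 (hfg j x)) hg
    (Eventually.of_forall fun x => tendsto_const_nhds.congr' (by
      filter_upwards [hlim x] with j hj
      simp [hj, ENNReal.zero_rpow_of_pos hp]))
  simpa using h

/-- The remainder `a - clip a N` is 1-Lipschitz in `a`, so both integrands are dominated by those of
`u`; at each point they vanish for large `N`. -/
lemma tendsto_energy_sub_clip (hp : 0 < p) (hu : Measurable u) (huE : energy Ω s p u ≠ ∞) :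
    Tendsto (fun N : ℕ => energy Ω s p (fun x => u x - clip (u x) N)) atTop (𝓝 0) := by
  have hm : ∀ N : ℕ, Measurable fun x => u x - clip (u x) N := fun N =>
    hu.sub (continuous_clip.measurable.comp (hu.prodMk measurable_const))
  have hev : ∀ x, ∀ᶠ N : ℕ in atTop, u x - clip (u x) N = 0 := fun x => by
    filter_upwards [tendsto_natCast_atTop_atTop.eventually_ge_atTop |u x|] with N hN
    rw [clip_eq_self hN, sub_self]
  have huE' := ENNReal.add_ne_top.1 huE
  have h1 := tendsto_lintegral_rpow_of_dominated (ν := volume.restrict Ω) hp hm huE'.1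
    (fun N x => by
      simpa [clip] using abs_sub_clip_sub_le (Nat.cast_nonneg N) (u x) 0) hev
  have h2 := tendsto_lintegral_rpow_of_dominated (ν := gagliardoMeasure Ω s p) hp
    (f := fun N z => (u z.1 - clip (u z.1) N) - (u z.2 - clip (u z.2) N))
    (g := fun z => u z.1 - u z.2)
    (fun N => ((hm N).comp measurable_fst).sub ((hm N).comp measurable_snd))
    (by rw [← gagliardo_eq_lintegral hp.le hu]; exact huE'.2)
    (fun N z => abs_sub_clip_sub_le (Nat.cast_nonneg N) _ _)
    (fun z => by
      filter_upwards [hev z.1, hev z.2] with N h1 h2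
      rw [h1, h2, sub_self])
  have := h1.add h2
  rw [add_zero] at this
  refine this.congr fun N => ?_
  rw [energy, gagliardo_eq_lintegral hp.le (hm N)]

/-- The measurable functions which are continuous on `Ω` and vanish in a neighbourhood of `K`. -/
def continuousVanishing (Ω K : Set (EuclideanSpace ℝ (Fin d))) :
    Submodule ℝ (EuclideanSpace ℝ (Fin d) → ℝ) where
  carrier := {v | Measurable v ∧ ContinuousOn v Ω ∧ ∀ᶠ x in 𝓝ˢ K, v x = 0}
  zero_mem' := ⟨measurable_zero, continuousOn_const, Eventually.of_forall fun _ => rfl⟩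
  add_mem' := by
    rintro v w ⟨hv, hv', hv0⟩ ⟨hw, hw', hw0⟩
    refine ⟨hv.add hw, hv'.add hw', ?_⟩
    filter_upwards [hv0, hw0] with x h1 h2
    simp [h1, h2]
  smul_mem' := by
    rintro c v ⟨hv, hv', hv0⟩
    refine ⟨hv.const_smul c, hv'.const_smul c, ?_⟩
    filter_upwards [hv0] with x h1
    simp [h1]

/-- Local averages clipped at height `N (1 - ψ j)` vanish near `K` and converge almost everywhere to
`clip u N`. The height has seminorm at most `N^p M`, so `N` must stay fixed here. -/
theorem exists_continuousVanishing_energy_sub_clip_lt {k : ℕ} (hk : 1 < k) (hkd : k < d)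
    (hkp : (k : ℝ) < p) (hsp : s * p = k) (hΩ : IsOpen Ω) (hΩ' : Ω ≠ Set.univ)
    (hK : IsCompact K) (hKΩ : K ⊆ Ω) (hKreg : IsLipschitzOfCodim Ω K k)
    (hu : Measurable u) (hui : Integrable u) (huE : energy Ω s p u ≠ ∞) (N : ℕ)
    {ε : ℝ≥0∞} (hε : 0 < ε) :
    ∃ v ∈ continuousVanishing Ω K, energy Ω s p (fun x => clip (u x) N - v x) < ε := by
  have hk1 : (1 : ℝ) < k := by exact_mod_cast hk
  have hp : 1 < p := hk1.trans hkp
  have hp0 : 0 ≤ p := by linarith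
  obtain ⟨M, hM, ψ, hψc, hψ01, hψK, hψE, hψlim⟩ :=
    hKreg.exists_cutoff hk hkd hkp hsp hΩ hK hKΩ
  set e : ℕ → ℝ := fun j => 1 / (2 * ((j : ℝ) + 1)) with he
  have he0 : ∀ j, 0 < e j := fun j => by positivity
  have he1 : ∀ j, e j ≤ 1 / 2 := fun j => by
    refine one_div_le_one_div_of_le two_pos ?_
    linarith [j.cast_nonneg (α := ℝ)]
  have helim : Tendsto e atTop (𝓝 0) := by
    have := (tendsto_one_div_add_atTop_nhds_zero_nat (𝕜 := ℝ)).const_mul (1 / 2)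
    rw [mul_zero] at this
    refine this.congr fun j => ?_
    exact one_div_mul_one_div _ _
  set C : ℝ≥0∞ := 2 ^ d + ENNReal.ofReal (2 ^ ((d : ℝ) + s * p)) * (2 ^ d * 2 ^ d) with hC
  have hCtop : C ≠ ∞ := by
    refine ENNReal.add_ne_top.2 ⟨by simp, ENNReal.mul_ne_top ENNReal.ofReal_ne_top ?_⟩
    exact ENNReal.mul_ne_top (by simp) (by simp)
  set h : ℕ → EuclideanSpace ℝ (Fin d) → ℝ := fun j x => N * (1 - ψ j x) with hh
  have hhc : ∀ j, Continuous (h j) := fun j => by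
    have := hψc j
    simp only [hh]
    fun_prop
  have hh0 : ∀ j x, 0 ≤ h j x := fun j x =>
    mul_nonneg (Nat.cast_nonneg N) (sub_nonneg.2 (hψ01 j x).2)
  have hhE : ∀ j, gagliardo Ω s p (h j) ≤ ‖(N : ℝ)‖ₑ ^ p * M := fun j => by
    refine le_trans (le_of_eq ?_) (mul_le_mul_right (hψE j) _)
    have hψm := (hψc j).measurable
    rw [gagliardo_eq_lintegral hp0 (hhc j).measurable, gagliardo_eq_lintegral hp0 hψm,
      ← lintegral_const_mul _ (by fun_prop)]
    refine lintegral_congr fun z => ?_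
    simp only [hh]
    rw [← mul_sub, sub_sub_sub_cancel_left, enorm_mul, ENNReal.mul_rpow_of_nonneg _ _ hp0,
      enorm_sub_rev]
  have hclip : Measurable fun x => clip (u x) N :=
    continuous_clip.measurable.comp (hu.prodMk measurable_const)
  refine exists_mem_energy_sub_lt hp (continuousVanishing Ω K) (fun v hv => hv.1) hclip ?_
    (f := fun j x => clip (localAverage Ω u (e j) x) (h j x)) (fun j => ⟨?_, ?_, ?_⟩)
    (M := C * energy Ω s p u + ‖(N : ℝ)‖ₑ ^ p * M) ?_ (fun j => ?_) ?_ hε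
  · refine ne_top_of_le_ne_top huE ?_
    have := energy_clip_le (Ω := Ω) (s := s) hp0 hu (h := fun _ => (N : ℝ)) measurable_const
      (fun _ => Nat.cast_nonneg N)
    simpa [gagliardo, Real.zero_rpow (by linarith : p ≠ 0)] using this
  · exact continuous_clip.measurable.comp
      ((measurable_localAverage hu _).prodMk (hhc j).measurable)
  · exact continuous_clip.comp_continuousOn
      ((continuousOn_localAverage hΩ hΩ' hui (he0 j)).prodMk (hhc j).continuousOn)
  · filter_upwards [hψK j] with x hx
    simp [hh, hx, clip_zero_right]
  · exact ENNReal.add_ne_top.2 ⟨ENNReal.mul_ne_top hCtop huE, ENNReal.mul_ne_top (by simp [hp0]) hM⟩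
  · refine (energy_clip_le hp0 (measurable_localAverage hu _) (hhc j).measurable (hh0 j)).trans ?_
    refine add_le_add (energy_localAverage_le hΩ hΩ' hp.le ?_ hu hui (he0 j) (he1 j)) (hhE j)
    rw [hsp]
    positivity
  · filter_upwards [ae_tendsto_localAverage hΩ hΩ' hui he0 helim, ae_restrict_of_ae hψlim]
      with x h1 h2
    have h3 : Tendsto (fun j => h j x) atTop (𝓝 N) := by
      simpa [hh] using (h2.const_sub 1).const_mul (N : ℝ)
    exact (continuous_clip.tendsto (u x, (N : ℝ))).comp (h1.prodMk_nhds h3)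

/-- Density of the continuous functions that vanish near `K`, at the level of functions. -/
theorem exists_continuousVanishing_energy_sub_le {k : ℕ} (hk : 1 < k) (hkd : k < d)
    (hkp : (k : ℝ) < p) (hsp : s * p = k) (hΩ : IsOpen Ω) (hΩ' : Ω ≠ Set.univ)
    (hK : IsCompact K) (hKΩ : K ⊆ Ω) (hKreg : IsLipschitzOfCodim Ω K k)
    (hu : Measurable u) (hui : IntegrableOn u Ω) (huE : energy Ω s p u ≠ ∞)
    {ε : ℝ≥0∞} (hε : 0 < ε) :
    ∃ v ∈ continuousVanishing Ω K, energy Ω s p (fun x => u x - v x) ≤ ε := by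
  have hk1 : (1 : ℝ) < k := by exact_mod_cast hk
  have hp : 1 < p := hk1.trans hkp
  -- Extension by zero outside `Ω` makes `u` globally integrable and leaves the energy unchanged.
  wlog hu0 : Integrable u generalizing u
  · have hae : Ω.indicator u =ᵐ[volume.restrict Ω] u := indicator_ae_eq_restrict hΩ.measurableSet
    obtain ⟨v, hv, hvE⟩ := this (hu.indicator hΩ.measurableSet) (hui.congr hae.symm)
      (by rwa [energy_congr_ae hae]) (hui.integrable_indicator hΩ.measurableSet)
    refine ⟨v, hv, (energy_congr_ae ?_).trans_le hvE⟩
    filter_upwards [hae] with x hx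
    rw [hx]
  set c : ℝ≥0∞ := 2 ^ (p - 1) with hc
  have hctop : c ≠ ∞ := ENNReal.rpow_ne_top_of_nonneg (by linarith) (by norm_num)
  have hη : 0 < ε / (c * 2) :=
    ENNReal.div_pos hε.ne' (ENNReal.mul_ne_top hctop (by norm_num))
  obtain ⟨N, hN⟩ := ((tendsto_energy_sub_clip (by linarith) hu huE).eventually_lt_const hη).exists
  obtain ⟨v, hv, hvE⟩ := exists_continuousVanishing_energy_sub_clip_lt hk hkd hkp hsp hΩ hΩ' hK hKΩ
    hKreg hu hu0 huE N hη
  have hclip : Measurable fun x => clip (u x) N :=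
    continuous_clip.measurable.comp (hu.prodMk measurable_const)
  refine ⟨v, hv, ?_⟩
  have h := energy_add_le (Ω := Ω) (s := s) hp.le (hu.sub hclip) (hclip.sub hv.1)
  simp only [Pi.sub_apply, sub_add_sub_cancel] at h
  calc _ ≤ _ := h
    _ ≤ c * (ε / (c * 2) + ε / (c * 2)) := by
        gcongr
        · exact hN.le
        · exact hvE.le
    _ = (c * 2) * (ε / (c * 2)) := by ring
    _ ≤ ε := ENNReal.mul_div_le

/-! ### From energies of functions to norms of classes in `L^p(Ω)`. -/

lemma eLpNorm_rpow_eq (hp : 0 < p) {X : Type*} [MeasurableSpace X] (ν : Measure X) (f : X → ℝ) :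
    eLpNorm f (ENNReal.ofReal p) ν ^ p = ∫⁻ x, ‖f x‖ₑ ^ p ∂ν := by
  rw [eLpNorm_eq_lintegral_rpow_enorm_toReal (by simpa using hp) ENNReal.ofReal_ne_top,
    ENNReal.toReal_ofReal hp.le, ← ENNReal.rpow_mul, one_div_mul_cancel hp.ne', ENNReal.rpow_one]

lemma fracSobolevNorm_eq (hp : 0 < p) : fracSobolevNorm Ω s p u = energy Ω s p u ^ (1 / p) := by
  rw [fracSobolevNorm, eLpNorm_rpow_eq hp, energy]

end
end

theorem mainTheorem4 (d k : ℕ) (hk : 1 < k) (hkd : k < d)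
    (s p : ℝ) (hs0 : 0 < s) (hs1 : s < 1) (hp : 1 < p) (hsp : s * p = (k : ℝ))
    (Ω K : Set (EuclideanSpace ℝ (Fin d)))
    (hΩ_open : IsOpen Ω) (hΩ_conn : IsConnected Ω) (hΩ_bdd : Bornology.IsBounded Ω)
    (hK : IsCompact K) (hKΩ : K ⊆ Ω) (hKreg : IsLipschitzOfCodim Ω K k) :
    fracSobolevZero Ω K s p = fracSobolev Ω s p := by
  have hp0 : 0 < p := by linarith
  have hkp : (k : ℝ) < p := by
    rw [← hsp]
    exact mul_lt_of_lt_one_left hp0 hs1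
  have hΩ' : Ω ≠ Set.univ := by
    rintro rfl
    have : Nonempty (Fin d) := ⟨⟨0, by omega⟩⟩
    exact NormedSpace.unbounded_univ ℝ (EuclideanSpace ℝ (Fin d)) hΩ_bdd
  have : IsFiniteMeasure (volume.restrict Ω) := ⟨by
    rw [Measure.restrict_apply_univ]
    exact hΩ_bdd.measure_lt_top⟩
  refine Set.Subset.antisymm (fun u hu => hu.1) fun u hu => ⟨hu, fun ε hε => ?_⟩
  have hum : Measurable u := (Lp.stronglyMeasurable u).measurable
  have huE : energy Ω s p u ≠ ∞ := by
    refine ENNReal.add_ne_top.2 ⟨?_, ne_of_lt hu⟩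
    rw [← eLpNorm_rpow_eq hp0]
    exact ENNReal.rpow_ne_top_of_nonneg hp0.le (Lp.eLpNorm_ne_top u)
  have hui : IntegrableOn u Ω := (Lp.memLp u).integrable (by simpa using hp.le)
  -- The energy is the `p`-th power of the norm; `η < ε^p` restores the strict inequality.
  obtain ⟨η, hη0, hη⟩ := exists_between (ENNReal.rpow_pos_of_nonneg hε hp0.le)
  obtain ⟨v, ⟨hvm, hvc, hvK⟩, hvE⟩ := exists_continuousVanishing_energy_sub_le hk hkd hkp hsp
    hΩ_open hΩ' hK hKΩ hKreg hum hui huE hη0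
  have hsubE : energy Ω s p (fun x => u x - v x) ≠ ∞ := (hvE.trans_lt (hη.trans_le le_top)).ne
  -- Membership in `continuousVanishing` gives no integrability, so it is read off from `v = u - (u
  -- - v)`.
  have hvmem : MemLp v (ENNReal.ofReal p) (volume.restrict Ω) := by
    have hw : MemLp (fun x => u x - v x) (ENNReal.ofReal p) (volume.restrict Ω) := by
      refine ⟨(hum.sub hvm).aestronglyMeasurable, ?_⟩
      have := (ENNReal.add_ne_top.1 hsubE).1
      rw [← eLpNorm_rpow_eq hp0] at this
      by_contra htop
      rw [not_lt_top_iff.1 htop, ENNReal.top_rpow_of_pos hp0] at this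
      exact this rfl
    refine ((Lp.memLp u).sub hw).ae_eq (Eventually.of_forall fun x => ?_)
    simp
  have hvenergy : energy Ω s p v ≠ ∞ := by
    have h1 := energy_sub_le (Ω := Ω) (s := s) hp.le hum (hum.sub hvm)
    simp only [Pi.sub_apply, sub_sub_cancel] at h1
    refine ne_top_of_le_ne_top (ENNReal.mul_ne_top ?_ (ENNReal.add_ne_top.2 ⟨huE, hsubE⟩)) h1
    exact ENNReal.rpow_ne_top_of_nonneg (by linarith) (by norm_num)
  have hae := hvmem.coeFn_toLp
  refine ⟨hvmem.toLp v, ⟨?_, v, hae, hvc, hvK⟩, ?_⟩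
  · change gagliardo Ω s p (hvmem.toLp v) < ∞
    rw [gagliardo_congr_ae hae]
    exact (ENNReal.add_ne_top.1 hvenergy).2.lt_top
  · have hsub : (u - hvmem.toLp v : Lp ℝ (ENNReal.ofReal p) (volume.restrict Ω))
        =ᵐ[volume.restrict Ω] fun x => u x - v x := by
      filter_upwards [Lp.coeFn_sub u (hvmem.toLp v), hae] with x h1 h2
      rw [h1, Pi.sub_apply, h2]
    rw [fracSobolevNorm_eq hp0, energy_congr_ae hsub]
    calc _ < (ε ^ p) ^ (1 / p) := ENNReal.rpow_lt_rpow (hvE.trans_lt hη) (by positivity)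
      _ = ε := by rw [← ENNReal.rpow_mul, mul_one_div_cancel hp0.ne', ENNReal.rpow_one]
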